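/- Let $M\ge 4$ and let the sites $1,\dots,M$ be arranged on a cycle (indices are taken modulo $M$). Let $U_i=\{i-1,i,i+1\}$. Consider the discrete-time Markov chain $\xi(t)=(\xi_1(t),\dots,\xi_M(t))\in\mathbb{Z}_+^M$, $t\in\mathbb{Z}_+$, that starts from a deterministic initial configuration $\xi(0)$ and evolves as follows: given $\xi(t)$, let $u_i(t)=\sum_{j\in U_i}\xi_j(t)$ be the potential of site $i$; choose a site $i$ uniformly at random among the sites at which $u_i(t)$ is minimal, and put $\xi_i(t+1)=\xi_i(t)+1$ and $\xi_j(t+1)=\xi_j(t)$ for $j\ne i$. (1) For every initial configuration, with probability $1$ the limit $\mathbf{x}=\lim_{t\to\infty}\xi(t)/t$ exists. It is a random vector that takes finitely many values, each with positive probability. (2) Call $\mathbf{x}\in\mathbb{R}^M$ a limiting configuration if there is an initial configuration from which $\xi(t)/t$ converges to $\mathbf{x}$ with positive probability. The set of limiting configurations is finite, and it consists exactly of those $\mathbf{x}=(x_1,\dots,x_M)\in\mathbb{R}^M$ for which there is an $\alpha>0$ such that all of the following hold: - $x_i\in\{0,\alpha/2,\alpha\}$ for all $i$, and $\sum_{i=1}^M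 x_i=1$; - if $x_i=0$, then $x_{i-1}>0$ or $x_{i+1}>0$ (or both); - if $x_i=\alpha/2$, then for some $j\in\{i,i+1\}$, $(x_{j-3},x_{j-2},x_{j-1},x_j,x_{j+1},x_{j+2})=(\alpha,0,\alpha/2,\alpha/2,0,\alpha)$; - if $x_i=\alpha$, then $x_{i-1}=x_{i+1}=0$; - if $M=3K$ is divisible by $3$, then $\min\{x_j,x_{j+3},\dots,x_{j+3(K-1)}\}=0$ for $j=1,2,3$. In particular, for every initial configuration the random limit almost surely satisfies these conditions. (3) For every initial configuration, with probability $1$, the adsorption eventually stops exactly at the sites where the limit vanishes: for every $i$, $\xi_i(t)$ is constant for all large $t$ if and only if $x_i=0$, and $\sup_{t\ge0}\xi_i(t)=\infty$ if and only if $x_i>0$. (4) If the initial configuration is empty ($\xi_i(0)=0$ for all $i$), then with probability $1$, for every $i$ with $x_i=0$ both $x_{i-1}>0$ and $x_{i+1}>0$. -/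

import Mathlib

open MeasureTheory ProbabilityTheory Filter Topology

noncomputable section

namespace Growth

/-- Particle configurations on the cycle of `M` sites; sites are residues modulo `M`, so that
`M + 1` is `1` and `1 - 1` is `M`. -/
abbrev Config (M : ℕ) : Type := ZMod M → ℕ

variable {M : ℕ} [NeZero M]

/-- The symmetric neighbourhood `U i = {i - 1, i, i + 1}`. -/
def nbhd (i : ZMod M) : Finset (ZMod M) := {i - 1, i, i + 1}

/-- The potential of site `i`. -/
def potential (c : Config M) (i : ZMod M) : ℕ := ∑ j ∈ nbhd i, c j

/-- The minimal potential. -/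
def minPotential (c : Config M) : ℕ :=
  Finset.univ.inf' Finset.univ_nonempty (potential c)

/-- The sites of minimal potential. -/
def minSites (c : Config M) : Finset (ZMod M) :=
  Finset.univ.filter fun i => potential c i = minPotential c

theorem minSites_nonempty (c : Config M) : (minSites c).Nonempty := by
  obtain ⟨i, hi, h⟩ := Finset.exists_mem_eq_inf' (Finset.univ_nonempty (α := ZMod M)) (potential c)
  exact ⟨i, Finset.mem_filter.2 ⟨hi, h.symm⟩⟩

/-- One step of the chain: a particle is added at a site chosen uniformly among the sites of
minimal potential. -/
def step (c : Config M) : PMF (Config M) :=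
  (PMF.uniformOfFinset (minSites c) (minSites_nonempty c)).map fun i => c + Pi.single i 1

/-- The one-step transition kernel. -/
def stepKernel (M : ℕ) [NeZero M] : Kernel (Config M) (Config M) :=
  Kernel.ofFunOfCountable fun c => (step c).toMeasure

instance (M : ℕ) [NeZero M] : IsMarkovKernel (stepKernel M) :=
  ⟨fun c => by
    change IsProbabilityMeasure (step c).toMeasure
    infer_instance⟩

/-- The transition kernel at time `n`, given the history up to time `n`: only the present counts. -/
def histKernel (M : ℕ) [NeZero M] (n : ℕ) :
    Kernel ((i : Finset.Iic n) → (fun _ : ℕ => Config M) i) (Config M) :=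
  (stepKernel M).comap (fun h => h ⟨n, Finset.mem_Iic.2 le_rfl⟩) (measurable_pi_apply _)

instance (M : ℕ) [NeZero M] (n : ℕ) : IsMarkovKernel (histKernel M n) := by
  unfold histKernel
  infer_instance

/-- The law, on the space of trajectories `ξ : ℕ → Config M`, of the growth process that starts
from the configuration `η` (the Ionescu-Tulcea measure of the transition kernel). -/
def law (η : Config M) : Measure (ℕ → Config M) :=
  Kernel.traj (X := fun _ : ℕ => Config M) (histKernel M) 0 fun _ => η

instance (η : Config M) : IsProbabilityMeasure (law η) := by
  unfold law
  infer_instance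

/-- `ξ(t) / t` converges to `x` as `t → ∞`. -/
def HasLimit (ξ : ℕ → Config M) (x : ZMod M → ℝ) : Prop :=
  Tendsto (fun (t : ℕ) (i : ZMod M) => (ξ t i : ℝ) / (t : ℝ)) atTop (𝓝 x)

/-- The list of properties that describes the limiting configurations. -/
structure Rules (x : ZMod M → ℝ) (α : ℝ) : Prop where
  pos : 0 < α
  mem : ∀ i, x i = 0 ∨ x i = α / 2 ∨ x i = α
  sum_eq : ∑ i, x i = 1
  zero : ∀ i, x i = 0 → 0 < x (i - 1) ∨ 0 < x (i + 1)
  half : ∀ i, x i = α / 2 → ∃ j, (j = i ∨ j = i + 1) ∧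
    x (j - 3) = α ∧ x (j - 2) = 0 ∧ x (j - 1) = α / 2 ∧
    x j = α / 2 ∧ x (j + 1) = 0 ∧ x (j + 2) = α
  full : ∀ i, x i = α → x (i - 1) = 0 ∧ x (i + 1) = 0
  mod_three : ∀ K : ℕ, M = 3 * K → ∀ j : ℕ, (j = 1 ∨ j = 2 ∨ j = 3) →
    IsLeast {y : ℝ | ∃ k : ℕ, k < K ∧ y = x ((j + 3 * k : ℕ) : ZMod M)} 0

/-- The configurations that satisfy the rules for some `α > 0`. -/
def ruleSet (M : ℕ) [NeZero M] : Set (ZMod M → ℝ) := {x | ∃ α : ℝ, Rules x α}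

end Growth

end

set_option linter.unusedSectionVars false

open MeasureTheory ProbabilityTheory Filter Topology

noncomputable section

namespace Growth

variable {M : ℕ} [NeZero M]

/-! Let `P` be a disjoint union of blocks, each a single site or a pair of neighbours, with gaps in
between. A particle on a single site raises the potential of that site and of both its neighbours; a
particle on either site of a pair raises both sites of the pair equally. So if the sites of `P` lie
within one of the minimum and everything else lies above it (`Tame`), a single site stays strictly
below its two neighbours, and the pattern can be left only through a site outside `P` that has no
isolated neighbour in `P` (`Tame.step`). If there is no such site (`Guarded`), the pattern is kept
for ever: sites outside `P` freeze, all blocks grow at the same rate, and the difference within a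
pair is a lazy symmetric walk, hence o(t) by an exponential moment and Borel–Cantelli. The limit is
`weight P i / blocks P` (`ae_absorbed`, `Absorbed.settles`).

Absorption is almost sure because its probability is bounded below by a constant depending on `M`
only. Progress is measured by the largest independent set of minimal sites and, at equal size, by
the number of minimal sites. If three consecutive sites are minimal, a prescribed filling of one
round improves this measure; if not, the minimal sites form a tame pattern, which either is guarded
or is left almost surely with a larger independent set. All this is phrased through nonnegative
superharmonic functions (`exists_lower_bound`). The probability of a shift-invariant event is
harmonic, so an event that is null from absorbing configurations is null from every configuration
(`law_eq_zero_of_absorbing`).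

The rules restate that `P` is guarded and free of triples, together with one arithmetic constraint:
if 3 divides `M`, the potentials have the same sum over each residue class modulo 3, so no class can
lie inside `P`. Conversely, potentials with equal orbit sums under translation by 3 can be realised
up to scale and an additive constant, which yields an absorbing configuration for every admissible
pattern (`exists_tame_of_rules`). For the empty start, an invariant of the potentials (`SpreadAt`)
excludes two adjacent frozen sites. -/

/-! ### The Markov property -/

/-- The trajectories that agree with `p` up to time `n`. -/
def prefixSet (p : ℕ → Config M) (n : ℕ) : Set (ℕ → Config M) := {ξ | ∀ i ≤ n, ξ i = p i}

theorem prefixSet_eq_preimage (p : ℕ → Config M) (n : ℕ) :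
    prefixSet p n = Preorder.frestrictLe (π := fun _ => Config M) n ⁻¹'
      {Preorder.frestrictLe (π := fun _ => Config M) n p} := by
  ext ξ
  simp only [prefixSet, Set.mem_ofPred_eq, Set.mem_preimage, Set.mem_singleton_iff, funext_iff,
    Preorder.frestrictLe_apply, Subtype.forall, Finset.mem_Iic]

theorem law_map_frestrictLe_singleton (η : Config M) (p : ℕ → Config M) (n : ℕ) :
    (law η).map (Preorder.frestrictLe (π := fun _ => Config M) n)
      {Preorder.frestrictLe (π := fun _ => Config M) n p} = law η (prefixSet p n) := by
  rw [Measure.map_apply (Preorder.measurable_frestrictLe n) (measurableSet_singleton _),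
    prefixSet_eq_preimage]

theorem law_prefixSet_zero (η : Config M) (p : ℕ → Config M) :
    law η (prefixSet p 0) = if p 0 = η then 1 else 0 := by
  rw [← law_map_frestrictLe_singleton, law, Kernel.traj_map_frestrictLe_apply,
    Kernel.partialTraj_self, Kernel.id_apply, Measure.dirac_apply' _ (measurableSet_singleton _)]
  by_cases h : p 0 = η
  · rw [if_pos h, Set.indicator_of_mem]
    · rfl
    · rw [Set.mem_singleton_iff]
      funext ⟨i, hi⟩
      obtain rfl : i = 0 := by simpa using hi
      exact h.symm
  · rw [if_neg h, Set.indicator_of_notMem]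
    intro h'
    exact h (congrFun (Set.mem_singleton_iff.1 h') ⟨0, by simp⟩).symm

theorem law_prefixSet_succ (η : Config M) (p : ℕ → Config M) (n : ℕ) :
    law η (prefixSet p (n + 1)) = law η (prefixSet p n) * step (p n) (p (n + 1)) := by
  have h := Kernel.partialTraj_compProd_eq_map_traj (X := fun _ : ℕ => Config M)
    (κ := histKernel M) (a := 0) (b := n) (Nat.zero_le n) (x₀ := fun _ => η)
  have h2 := congrArg (fun μ => μ ({Preorder.frestrictLe (π := fun _ => Config M) n p} ×ˢ
    {p (n + 1)})) h
  rw [Measure.map_apply (by fun_prop)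
    ((measurableSet_singleton _).prod (measurableSet_singleton _)),
    Measure.compProd_apply_prod (measurableSet_singleton _) (measurableSet_singleton _),
    Measure.restrict_singleton, lintegral_smul_measure, lintegral_dirac,
    ← Kernel.traj_map_frestrictLe_apply] at h2
  have e : (fun x : ℕ → Config M => (Preorder.frestrictLe (π := fun _ => Config M) n x, x (n + 1)))
      ⁻¹' ({Preorder.frestrictLe (π := fun _ => Config M) n p} ×ˢ {p (n + 1)}) =
      prefixSet p (n + 1) := by
    rw [Set.mk_preimage_prod, ← prefixSet_eq_preimage]
    ext ξ
    simp only [prefixSet, Set.mem_inter_iff, Set.mem_ofPred_eq, Set.mem_preimage,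
      Set.mem_singleton_iff]
    constructor
    · rintro ⟨h, h'⟩ i hi
      rcases Nat.le_succ_iff.1 hi with hi | rfl
      exacts [h i hi, h']
    · intro h
      exact ⟨fun i hi => h i (by omega), h _ le_rfl⟩
  rw [e] at h2
  have h3 := law_map_frestrictLe_singleton η p n
  rw [law] at h3
  rw [h3] at h2
  rw [law, ← h2, smul_eq_mul]
  congr 1
  change (step (p n)).toMeasure {p (n + 1)} = _
  rw [PMF.toMeasure_apply_singleton _ _ (measurableSet_singleton _)]

/-- Configurations form a countable discrete space, so the prefix sets are the atoms of the
finite-time marginals; these marginals determine a measure on trajectories by uniqueness of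
projective limits. -/
theorem measure_ext_of_prefixSet {μ ν : Measure (ℕ → Config M)} [IsProbabilityMeasure μ]
    [IsProbabilityMeasure ν] (h : ∀ p n, μ (prefixSet p n) = ν (prefixSet p n)) : μ = ν := by
  have key : ∀ n, μ.map (Preorder.frestrictLe (π := fun _ => Config M) n) =
      ν.map (Preorder.frestrictLe (π := fun _ => Config M) n) := by
    intro n
    refine Measure.ext_of_singleton fun q => ?_
    obtain ⟨p, rfl⟩ : ∃ p : ℕ → Config M, Preorder.frestrictLe (π := fun _ => Config M) n p = q :=
      ⟨fun i => if hi : i ≤ n then q ⟨i, Finset.mem_Iic.2 hi⟩ else 0, by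
        funext ⟨i, hi⟩
        simp [Finset.mem_Iic.1 hi]⟩
    rw [Measure.map_apply (Preorder.measurable_frestrictLe n) (measurableSet_singleton _),
      Measure.map_apply (Preorder.measurable_frestrictLe n) (measurableSet_singleton _),
      ← prefixSet_eq_preimage, h]
  have hν : IsProjectiveLimit ν (fun I => ν.map I.restrict) := fun I => rfl
  have hp : IsProjectiveMeasureFamily (α := fun _ : ℕ => Config M) (fun I => ν.map I.restrict) := by
    intro I J hJI
    rw [Measure.map_map (Finset.measurable_restrict₂ hJI) (Finset.measurable_restrict _)]
    rfl
  refine IsProjectiveLimit.unique ((isProjectiveLimit_nat_iff hp μ).2 fun n => ?_) hν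
  exact key n

/-- The time shift on trajectories. -/
def shift (ξ : ℕ → Config M) : ℕ → Config M := fun t => ξ (t + 1)

theorem measurable_shift : Measurable (shift (M := M)) :=
  measurable_pi_lambda _ fun t => measurable_pi_apply (t + 1)

theorem minSites_card_pos (c : Config M) : 0 < (minSites c).card :=
  Finset.card_pos.2 (minSites_nonempty c)

theorem step_apply (c c' : Config M) :
    step c c' = (((minSites c).card : ENNReal))⁻¹ *
      ∑ i ∈ minSites c, if c' = c + Pi.single i 1 then 1 else 0 := by
  classical
  rw [step, PMF.map_apply, tsum_eq_sum (s := minSites c), Finset.mul_sum]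
  · refine Finset.sum_congr rfl fun i hi => ?_
    rw [PMF.uniformOfFinset_apply_of_mem _ hi]
    split_ifs <;> simp
  · intro i hi
    rw [PMF.uniformOfFinset_apply_of_notMem _ hi]
    simp

theorem law_prefixSet_cons (η c : Config M) (p : ℕ → Config M) (n : ℕ) :
    law η (prefixSet (fun t => Nat.casesOn t c p) (n + 1)) =
      (if c = η then 1 else 0) * (step c (p 0) * law (p 0) (prefixSet p n)) := by
  induction n with
  | zero =>
    rw [law_prefixSet_succ, law_prefixSet_zero, law_prefixSet_zero]
    simp
  | succ n ih =>
    rw [law_prefixSet_succ, ih, law_prefixSet_succ]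
    simp only [mul_assoc]

theorem law_prefixSet_of_ne (η : Config M) (p : ℕ → Config M) (h : p 0 ≠ η) (n : ℕ) :
    law η (prefixSet p n) = 0 := by
  induction n with
  | zero => rw [law_prefixSet_zero, if_neg h]
  | succ n ih => rw [law_prefixSet_succ, ih, zero_mul]

theorem law_zero_time (η : Config M) : ∀ᵐ ξ ∂(law η), ξ 0 = η := by
  have h : law η (prefixSet (fun _ => η) 0) = 1 := by rw [law_prefixSet_zero, if_pos rfl]
  have hm : MeasurableSet (prefixSet (fun _ : ℕ => η) 0) := by
    rw [prefixSet_eq_preimage]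
    exact Preorder.measurable_frestrictLe 0 (measurableSet_singleton _)
  have h2 := (prob_compl_eq_zero_iff hm).2 h
  refine measure_mono_null (fun ξ hξ => ?_) h2
  exact fun h' => hξ (h' 0 le_rfl)

/-- The Markov property at time one. -/
theorem law_map_shift (η : Config M) :
    (law η).map shift =
      ((minSites η).card : ENNReal)⁻¹ • ∑ i ∈ minSites η, law (η + Pi.single i 1) := by
  have h0 : ((minSites η).card : ENNReal) ≠ 0 := by exact_mod_cast (minSites_card_pos η).ne'
  have hT : ((minSites η).card : ENNReal) ≠ ⊤ := ENNReal.natCast_ne_top _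
  have : IsProbabilityMeasure ((law η).map (shift (M := M))) :=
    Measure.isProbabilityMeasure_map measurable_shift.aemeasurable
  have : IsProbabilityMeasure
      (((minSites η).card : ENNReal)⁻¹ • ∑ i ∈ minSites η, law (η + Pi.single i 1)) := by
    constructor
    rw [Measure.smul_apply, Measure.finsetSum_apply]
    simp [ENNReal.inv_mul_cancel h0 hT]
  refine measure_ext_of_prefixSet fun p n => ?_
  have hm : MeasurableSet (prefixSet p n) := by
    rw [prefixSet_eq_preimage]
    exact Preorder.measurable_frestrictLe n (measurableSet_singleton _)
  have e : law η (shift ⁻¹' prefixSet p n) =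
      law η (prefixSet (fun t => Nat.casesOn t η p) (n + 1)) := by
    refine measure_congr ?_
    filter_upwards [law_zero_time η] with ξ hξ
    refine propext ⟨fun h i hi => ?_, fun h i hi => h (i + 1) (by omega)⟩
    cases i with
    | zero => exact hξ
    | succ i => exact h i (by omega)
  rw [Measure.map_apply measurable_shift hm, e, law_prefixSet_cons, if_pos rfl, one_mul,
    step_apply, Measure.smul_apply, Measure.finsetSum_apply, smul_eq_mul, mul_assoc,
    Finset.sum_mul]
  congr 1
  refine Finset.sum_congr rfl fun i _ => ?_
  split_ifs with h
  · rw [h, one_mul]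
  · rw [zero_mul, law_prefixSet_of_ne _ _ h]

theorem lintegral_shift (η : Config M) {F : (ℕ → Config M) → ENNReal} (hF : Measurable F) :
    ∫⁻ ξ, F (shift ξ) ∂(law η) =
      ((minSites η).card : ENNReal)⁻¹ *
        ∑ i ∈ minSites η, ∫⁻ ξ, F ξ ∂(law (η + Pi.single i 1)) := by
  rw [← lintegral_map hF measurable_shift, law_map_shift, lintegral_smul_measure,
    lintegral_finsetSum_measure, smul_eq_mul]

/-- The probability of a shift-invariant event is a harmonic function of the starting point. -/
theorem law_real_eq_average (η : Config M) {E : Set (ℕ → Config M)} (hE : MeasurableSet E)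
    (hs : ∀ ξ, shift ξ ∈ E ↔ ξ ∈ E) :
    ((minSites η).card : ℝ) * (law η).real E =
      ∑ i ∈ minSites η, (law (η + Pi.single i 1)).real E := by
  have h : law η E = ((minSites η).card : ENNReal)⁻¹ *
      ∑ i ∈ minSites η, law (η + Pi.single i 1) E := by
    have h1 : law η E = (law η).map shift E := by
      rw [Measure.map_apply measurable_shift hE]
      congr 1
      ext ξ
      exact (hs ξ).symm
    rw [h1, law_map_shift, Measure.smul_apply, Measure.finsetSum_apply, smul_eq_mul]
  have h0 : ((minSites η).card : ℝ) ≠ 0 := by exact_mod_cast (minSites_card_pos η).ne'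
  rw [Measure.real, h, ENNReal.toReal_mul, ENNReal.toReal_inv, ENNReal.toReal_natCast,
    ENNReal.toReal_sum fun i _ => measure_ne_top _ _, mul_inv_cancel_left₀ h0]
  rfl

/-- Almost surely every step adds a particle at a site of minimal potential; hence a property that
is preserved by such steps holds at all times. -/
theorem law_forall_of_closed {Q : Config M → Prop}
    (hQ : ∀ c, Q c → ∀ i ∈ minSites c, Q (c + Pi.single i 1)) (t : ℕ) :
    ∀ η, Q η → ∀ᵐ ξ ∂(law η), Q (ξ t) ∧ ∃ i ∈ minSites (ξ t), ξ (t + 1) = ξ t + Pi.single i 1 := by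
  induction t with
  | zero =>
    intro η hη
    have h1 : ∀ᵐ ξ ∂(law η).map shift, ∃ i ∈ minSites η, ξ 0 = η + Pi.single i 1 := by
      rw [law_map_shift]
      refine Measure.ae_smul_measure ?_ _
      rw [ae_finsetSum_measure_iff]
      intro i hi
      filter_upwards [law_zero_time (η + Pi.single i 1)] with ξ hξ
      exact ⟨i, hi, hξ⟩
    filter_upwards [law_zero_time η, ae_of_ae_map measurable_shift.aemeasurable h1] with ξ h0 h1
    rw [h0]
    exact ⟨hη, h1⟩
  | succ t ih =>
    intro η hη
    have h1 : ∀ᵐ ξ ∂(law η).map shift, Q (ξ t) ∧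
        ∃ i ∈ minSites (ξ t), ξ (t + 1) = ξ t + Pi.single i 1 := by
      rw [law_map_shift]
      refine Measure.ae_smul_measure ?_ _
      rw [ae_finsetSum_measure_iff]
      exact fun i hi => ih _ (hQ η hη i hi)
    exact ae_of_ae_map measurable_shift.aemeasurable h1

/-! ### The effect of one step on the potentials -/

theorem one_ne_zero_zmod (hM : 4 ≤ M) : (1 : ZMod M) ≠ 0 := by
  have h : ((1 : ℕ) : ZMod M) ≠ 0 := fun h => by
    have := Nat.le_of_dvd (by norm_num) ((ZMod.natCast_eq_zero_iff 1 M).1 h); omega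
  simpa using h

theorem two_ne_zero_zmod (hM : 4 ≤ M) : (2 : ZMod M) ≠ 0 := by
  have h : ((2 : ℕ) : ZMod M) ≠ 0 := fun h => by
    have := Nat.le_of_dvd (by norm_num) ((ZMod.natCast_eq_zero_iff 2 M).1 h); omega
  simpa using h

theorem three_ne_zero_zmod (hM : 4 ≤ M) : (3 : ZMod M) ≠ 0 := by
  have h : ((3 : ℕ) : ZMod M) ≠ 0 := fun h => by
    have := Nat.le_of_dvd (by norm_num) ((ZMod.natCast_eq_zero_iff 3 M).1 h); omega
  simpa using h

theorem offsets_ne (hM : 4 ≤ M) (j : ZMod M) :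
    j - 1 ≠ j ∧ j + 1 ≠ j ∧ j - 2 ≠ j ∧ j + 2 ≠ j ∧ j - 1 ≠ j + 1 ∧ j - 2 ≠ j - 1 ∧ j - 2 ≠ j + 1 ∧
      j + 2 ≠ j - 1 ∧ j + 2 ≠ j + 1 ∧ j + 3 ≠ j ∧ j - 3 ≠ j := by
  have h1 := one_ne_zero_zmod hM
  have h2 := two_ne_zero_zmod hM
  have h3 := three_ne_zero_zmod hM
  refine ⟨fun h => h1 ?_, fun h => h1 ?_, fun h => h2 ?_, fun h => h2 ?_, fun h => h2 ?_,
    fun h => h1 ?_, fun h => h3 ?_, fun h => h3 ?_, fun h => h1 ?_, fun h => h3 ?_, fun h => h3 ?_⟩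
  · linear_combination -h
  · linear_combination h
  · linear_combination -h
  · linear_combination h
  · linear_combination -h
  · linear_combination -h
  · linear_combination -h
  · linear_combination h
  · linear_combination h
  · linear_combination h
  · linear_combination -h

theorem mem_nbhd {p i : ZMod M} : p ∈ nbhd i ↔ p = i - 1 ∨ p = i ∨ p = i + 1 := by
  simp [nbhd]

theorem potential_eq (hM : 4 ≤ M) (c : Config M) (i : ZMod M) :
    potential c i = c (i - 1) + c i + c (i + 1) := by
  have h1 := one_ne_zero_zmod hM
  rw [potential, nbhd, Finset.sum_insert, Finset.sum_insert, Finset.sum_singleton, add_assoc]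
  · simp [h1]
  · simp only [Finset.mem_insert, Finset.mem_singleton]
    have := offsets_ne hM i
    tauto

theorem potential_add (c d : Config M) (i : ZMod M) :
    potential (c + d) i = potential c i + potential d i := by
  simp [potential, Finset.sum_add_distrib]

theorem potential_single (p i : ZMod M) :
    potential (Pi.single p 1) i = if p ∈ nbhd i then 1 else 0 := by
  simp [potential, Pi.single_apply]

theorem potential_step (c : Config M) (p i : ZMod M) :
    potential (c + Pi.single p 1) i =
      potential c i + if p = i - 1 ∨ p = i ∨ p = i + 1 then 1 else 0 := by
  rw [potential_add, potential_single]
  simp only [mem_nbhd]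

theorem minPotential_le (c : Config M) (i : ZMod M) : minPotential c ≤ potential c i :=
  Finset.inf'_le _ (Finset.mem_univ i)

theorem le_minPotential {c : Config M} {n : ℕ} (h : ∀ i, n ≤ potential c i) :
    n ≤ minPotential c :=
  Finset.le_inf' _ _ fun i _ => h i

theorem mem_minSites {c : Config M} {i : ZMod M} :
    i ∈ minSites c ↔ potential c i = minPotential c := by
  simp [minSites]

/-! ### Tame configurations -/

/-- The set contains no three consecutive sites. -/
def NoTriple (P : Finset (ZMod M)) : Prop := ∀ a, a ∈ P → a + 1 ∈ P → a + 2 ∉ P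

/-- An isolated site of `P`. -/
def Iso (P : Finset (ZMod M)) (i : ZMod M) : Prop := i ∈ P ∧ i - 1 ∉ P ∧ i + 1 ∉ P

/-- Within the present round, exactly the blocks of `P` (single sites or pairs of neighbours)
attract particles. -/
structure Tame (P : Finset (ZMod M)) (c : Config M) : Prop where
  noTriple : NoTriple P
  le : ∀ a ∈ P, potential c a ≤ minPotential c + 1
  eq : ∀ a ∈ P, a + 1 ∈ P → potential c a = potential c (a + 1)
  gt : ∀ j ∉ P, minPotential c < potential c j
  iso : ∀ i, Iso P i → potential c i < potential c (i - 1) ∧ potential c i < potential c (i + 1)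

/-- Every site outside `P` has an isolated neighbour in `P`. -/
def Guarded (P : Finset (ZMod M)) : Prop := ∀ j ∉ P, Iso P (j - 1) ∨ Iso P (j + 1)

theorem Tame.mem {P : Finset (ZMod M)} {c : Config M} (h : Tame P c) {p : ZMod M}
    (hp : p ∈ minSites c) : p ∈ P := by
  by_contra hpP
  exact (h.gt p hpP).ne' (mem_minSites.1 hp)

theorem Tame.potential_step_le {P : Finset (ZMod M)} {c : Config M} (h : Tame P c) {p a : ZMod M}
    (hp : p ∈ minSites c) (ha : a ∈ P) :
    potential (c + Pi.single p 1) a ≤ minPotential c + 1 := by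
  have hpu := mem_minSites.1 hp
  have hpP := h.mem hp
  have hla := h.le a ha
  rw [potential_step]
  split_ifs with hpa
  · have : potential c a = minPotential c := by
      rcases hpa with rfl | rfl | rfl
      · rw [← hpu]
        have := h.eq (a - 1) hpP (by simpa using ha)
        simpa using this.symm
      · exact hpu
      · rw [← hpu]; exact h.eq a ha hpP
    omega
  · omega

/-- A step from a tame configuration either keeps it tame, or ends the round with a new site of
minimal potential, which is not next to an isolated site. -/
theorem Tame.step {P : Finset (ZMod M)} {c : Config M} (h : Tame P c) {p : ZMod M}
    (hp : p ∈ minSites c) :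
    Tame P (c + Pi.single p 1) ∨ P ⊆ minSites (c + Pi.single p 1) ∧
      ∃ j ∉ P, j ∈ minSites (c + Pi.single p 1) ∧ ¬ Iso P (j - 1) ∧ ¬ Iso P (j + 1) := by
  have hpP := h.mem hp
  have hpu := mem_minSites.1 hp
  set c' := c + Pi.single p 1 with hc'
  have hstep := potential_step c p
  rw [← hc'] at hstep
  have hpu' : potential c' p = minPotential c + 1 := by rw [hstep, hpu]; simp
  have hmono : ∀ i, potential c i ≤ potential c' i := fun i => by rw [hstep]; omega
  have hle : ∀ a ∈ P, potential c' a ≤ minPotential c + 1 := fun a ha => h.potential_step_le hp ha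
  -- A pair is flanked by sites outside `P`, so the particle lands on the pair, raising both of its
  -- sites, or misses both neighbourhoods.
  have heq : ∀ a ∈ P, a + 1 ∈ P → potential c' a = potential c' (a + 1) := by
    intro a ha ha1
    have h4 := h.noTriple a ha ha1
    have h5 := h.noTriple (a - 1)
    have e := h.eq a ha ha1
    have e1 : a - 1 + 1 = a := by ring
    have e2 : a - 1 + 2 = a + 1 := by ring
    have e3 : a + 1 + 1 = a + 2 := by ring
    rw [e1, e2] at h5
    rw [hstep, hstep, e]
    have e4 : a + 1 - 1 = a := by ring
    rw [e3, e4]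
    have : p ≠ a - 1 := fun h => h5 (h ▸ hpP) ha ha1
    have : p ≠ a + 2 := fun h => h4 (h ▸ hpP)
    grind
  have hgt : ∀ j ∉ P, minPotential c < potential c' j := fun j hj => (h.gt j hj).trans_le (hmono j)
  have hiso : ∀ i, Iso P i → potential c' i < potential c' (i - 1) ∧
      potential c' i < potential c' (i + 1) := by
    intro i hi
    have hh := h.iso i hi
    obtain ⟨hi1, hi2, hi3⟩ := hi
    have : p ≠ i - 1 := fun h => hi2 (h ▸ hpP)
    have : p ≠ i + 1 := fun h => hi3 (h ▸ hpP)
    simp only [hstep]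
    -- A particle at `i` lifts both neighbours together with `i`; no other particle in `P` reaches
    -- `i`, since `i - 1` and `i + 1` are outside `P`. Both strict inequalities persist.
    by_cases hpi : p = i
    · subst hpi
      simp
      omega
    · rw [if_neg (by tauto)]
      omega
  have hmin : minPotential c' ≤ minPotential c + 1 := hpu' ▸ minPotential_le c' p
  have hmin' : minPotential c ≤ minPotential c' :=
    le_minPotential fun i => (minPotential_le c i).trans (hmono i)
  rcases Nat.lt_or_ge (minPotential c) (minPotential c') with hlt | hge
  -- The round is over: every site of `P` sits at the new minimum. The only possible loss of
  -- tameness is a site outside `P` that has been caught up with.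
  · have hmeq : minPotential c' = minPotential c + 1 := by omega
    by_cases hj : ∃ j ∉ P, j ∈ minSites c'
    · right
      refine ⟨fun a ha => mem_minSites.2 ?_, ?_⟩
      · have := minPotential_le c' a
        have := hle a ha
        omega
      · obtain ⟨j, hjP, hj⟩ := hj
        refine ⟨j, hjP, hj, fun hi => ?_, fun hi => ?_⟩
        · have := (hiso _ hi).2
          have := minPotential_le c' (j - 1)
          rw [sub_add_cancel, mem_minSites.1 hj] at *
          omega
        · have := (hiso _ hi).1
          have := minPotential_le c' (j + 1)
          rw [add_sub_cancel_right, mem_minSites.1 hj] at *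
          omega
    · left
      push Not at hj
      refine ⟨h.noTriple, fun a ha => by have := hle a ha; omega, heq, fun j hjP => ?_, hiso⟩
      exact lt_of_le_of_ne (minPotential_le c' j) fun e => hj j hjP (mem_minSites.2 e.symm)
  · left
    have hmeq : minPotential c' = minPotential c := by omega
    exact ⟨h.noTriple, by rwa [hmeq], heq, by rwa [hmeq], hiso⟩

/-- Leaving the pattern requires a site without isolated neighbour, which a guarded pattern lacks.
Guarded tame configurations are the absorbing ones of the whole argument. -/
theorem Tame.step_guarded {P : Finset (ZMod M)} (hP : Guarded P) {c : Config M}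
    (h : Tame P c) {p : ZMod M} (hp : p ∈ minSites c) : Tame P (c + Pi.single p 1) := by
  rcases h.step hp with h | ⟨-, j, hj, -, h1, h2⟩
  · exact h
  · exact absurd (hP j hj) (by tauto)

theorem tame_minSites {c : Config M} (h : NoTriple (minSites c)) : Tame (minSites c) c where
  noTriple := h
  le a ha := by rw [mem_minSites.1 ha]; omega
  eq a ha ha' := by rw [mem_minSites.1 ha, mem_minSites.1 ha']
  gt j hj := lt_of_le_of_ne (minPotential_le c j) fun e => hj (mem_minSites.2 e.symm)
  iso i hi := by
    rw [mem_minSites.1 hi.1]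
    exact ⟨lt_of_le_of_ne (minPotential_le c _) fun e => hi.2.1 (mem_minSites.2 e.symm),
      lt_of_le_of_ne (minPotential_le c _) fun e => hi.2.2 (mem_minSites.2 e.symm)⟩

/-! ### Independent sets -/

/-- No two neighbouring sites. -/
def Indep (I : Finset (ZMod M)) : Prop := ∀ i ∈ I, i + 1 ∉ I

/-- A tame set that acquires a site not next to an isolated one gets a larger independent set. -/
theorem Indep.exists_larger (hM : 4 ≤ M) {P I : Finset (ZMod M)} (hP : NoTriple P) (hI : Indep I)
    (hIP : I ⊆ P) {j : ZMod M} (hj : j ∉ P) (h1 : ¬ Iso P (j - 1)) (h2 : ¬ Iso P (j + 1)) :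
    ∃ J, Indep J ∧ J ⊆ insert j P ∧ I.card + 1 ≤ J.card := by
  have z1 := one_ne_zero_zmod hM
  have off := offsets_ne hM j
  have hl : j - 1 ∈ P → j - 2 ∈ P ∧ j - 3 ∉ P := by
    intro h
    have e : j - 1 - 1 = j - 2 := by ring
    have e' : j - 1 + 1 = j := by ring
    have h2 : j - 2 ∈ P := by
      by_contra h'
      exact h1 ⟨h, by rwa [e], by rwa [e']⟩
    refine ⟨h2, fun h3 => hP _ h3 ?_ ?_⟩
    · convert h2 using 1; ring
    · convert h using 1; ring
  have hr : j + 1 ∈ P → j + 2 ∈ P ∧ j + 3 ∉ P := by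
    intro h
    have e : j + 1 + 1 = j + 2 := by ring
    have e' : j + 1 - 1 = j := by ring
    have h2 : j + 2 ∈ P := by
      by_contra h'
      exact h2 ⟨h, by rwa [e'], by rwa [e]⟩
    refine ⟨h2, ?_⟩
    have := hP _ h (by rwa [e])
    convert this using 2; ring
  -- This matters when `M = 4`: the pairs on the two sides of `j` could otherwise share their outer
  -- site.
  have hne : j - 1 ∈ P → j + 1 ∈ P → j - 2 ≠ j + 2 := by
    intro ha hb he
    have h3 := (hl ha).2
    apply h3
    have : j - 3 = j + 1 := by linear_combination he
    rwa [this]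
  -- Neighbours of `j` in `P` belong to pairs. Moving an element of `I` from such a neighbour to the
  -- other site of its pair makes room for `j` itself.
  let φ : ZMod M → ZMod M := fun i => if i = j - 1 then j - 2 else if i = j + 1 then j + 2 else i
  have hφ : ∀ i, φ i = if i = j - 1 then j - 2 else if i = j + 1 then j + 2 else i := fun _ => rfl
  have hmem : ∀ i ∈ I, φ i ∈ P ∧ φ i ≠ j - 1 ∧ φ i ≠ j + 1 := by
    intro i hi
    have := hIP hi
    rw [hφ]
    split_ifs with e1 e2
    · subst e1
      exact ⟨(hl this).1, by tauto, by tauto⟩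
    · subst e2
      exact ⟨(hr this).1, by tauto, by tauto⟩
    · exact ⟨this, e1, e2⟩
  have hinj : Set.InjOn φ I := by
    intro x hx y hy hxy
    have hx' := hI x hx
    have hy' := hI y hy
    have hxP := hIP hx
    have hyP := hIP hy
    simp only [hφ] at hxy
    split_ifs at hxy <;> grind
  refine ⟨insert j (I.image φ), ?_, ?_, ?_⟩
  · intro x hx hx1
    simp only [Finset.mem_insert, Finset.mem_image] at hx hx1
    rcases hx with rfl | ⟨y, hy, rfl⟩
    · rcases hx1 with h | ⟨z, hz, h⟩
      · exact z1 (by linear_combination h)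
      · exact (hmem z hz).2.2 h
    · rcases hx1 with h | ⟨z, hz, h⟩
      · exact (hmem y hy).2.1 (by linear_combination h)
      · have a1 := hmem y hy
        have a2 := hmem z hz
        have b1 := hI y hy
        have b2 := hIP hy
        have b3 := hIP hz
        have b4 := hI z hz
        simp only [hφ] at h a1 a2
        split_ifs at h a1 a2 <;> grind
  · intro x hx
    simp only [Finset.mem_insert, Finset.mem_image] at hx ⊢
    rcases hx with rfl | ⟨y, hy, rfl⟩
    · exact Or.inl rfl
    · exact Or.inr (hmem y hy).1
  · rw [Finset.card_insert_of_notMem, Finset.card_image_of_injOn hinj]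
    intro h
    obtain ⟨y, hy, h⟩ := Finset.mem_image.1 h
    exact hj (h ▸ (hmem y hy).1)

/-- Once `J` has been filled, the site `b` between two sites of `J` has gained two and is no longer
minimal. This is how a triple of minimal sites makes the minimal set shrink without loss in the
independent set. -/
theorem Indep.exists_double (hM : 4 ≤ M) {A I : Finset (ZMod M)} (hI : Indep I) (hIA : I ⊆ A)
    {a : ZMod M} (h0 : a ∈ A) (h1 : a + 1 ∈ A) (h2 : a + 2 ∈ A) :
    ∃ J, Indep J ∧ J ⊆ A ∧ I.card ≤ J.card ∧ ∃ b ∈ A, b - 1 ∈ J ∧ b + 1 ∈ J := by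
  by_cases hl : a - 1 ∈ I ∧ a + 1 ∈ I
  · exact ⟨I, hI, hIA, le_rfl, a, h0, hl⟩
  by_cases hr : a + 1 ∈ I ∧ a + 3 ∈ I
  · refine ⟨I, hI, hIA, le_rfl, a + 2, h2, ?_, ?_⟩
    · convert hr.1 using 1; ring
    · convert hr.2 using 1; ring
  have off := offsets_ne hM a
  have off1 := offsets_ne hM (a + 1)
  let L : Finset (ZMod M) := {a - 1, a, a + 1, a + 2, a + 3}
  have hL : ∀ x, x ∈ L ↔ x = a - 1 ∨ x = a ∨ x = a + 1 ∨ x = a + 2 ∨ x = a + 3 := by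
    intro x; simp [L]
  have e1 : a - 1 + 1 = a := by ring
  have e2 : a + 1 + 1 = a + 2 := by ring
  have e3 : a + 2 + 1 = a + 3 := by ring
  have e4 : a + 1 - 2 = a - 1 := by ring
  have e5 : a + 1 + 2 = a + 3 := by ring
  have i1 := hI (a - 1)
  have i2 := hI a
  have i3 := hI (a + 1)
  have i4 := hI (a + 2)
  rw [e1] at i1
  rw [e2] at i3
  rw [e3] at i4
  -- If `a + 1` is in `I`, the two excluded cases and independence leave nothing else of `L`.
  -- Otherwise `I` has at most one site in `{a - 1, a}` and at most one in `{a + 2, a + 3}`.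
  have hcard : (I ∩ L).card ≤ 2 := by
    have : ∃ x y, I ∩ L ⊆ {x, y} := by
      by_cases hm : a + 1 ∈ I
      · refine ⟨a + 1, a + 1, fun x hx => ?_⟩
        obtain ⟨hxI, hxL⟩ := Finset.mem_inter.1 hx
        rcases (hL x).1 hxL with rfl | rfl | rfl | rfl | rfl
        · exact absurd ⟨hxI, hm⟩ hl
        · exact absurd hm (i2 hxI)
        · simp
        · exact absurd hxI (i3 hm)
        · exact absurd ⟨hm, hxI⟩ hr
      · refine ⟨if a ∈ I then a else a - 1, if a + 2 ∈ I then a + 2 else a + 3, fun x hx => ?_⟩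
        obtain ⟨hxI, hxL⟩ := Finset.mem_inter.1 hx
        rcases (hL x).1 hxL with rfl | rfl | rfl | rfl | rfl
        · rw [if_neg (i1 hxI)]; simp
        · rw [if_pos hxI]; simp
        · exact absurd hxI hm
        · rw [if_pos hxI]; simp
        · rw [if_neg (fun h => i4 h hxI)]; simp
    obtain ⟨x, y, h⟩ := this
    exact (Finset.card_le_card h).trans Finset.card_le_two
  -- The at most two sites of `I` in the window are traded for `a` and `a + 2`; clearing `a - 1` and
  -- `a + 3` as well keeps independence.
  refine ⟨insert a (insert (a + 2) (I \ L)), ?_, ?_, ?_, a + 1, h1, ?_, ?_⟩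
  · intro x hx hx1
    simp only [Finset.mem_insert, Finset.mem_sdiff, hL] at hx hx1
    rcases hx with rfl | rfl | ⟨hx, hxL⟩
    · rcases hx1 with h | h | h
      · exact off.2.1 h
      · exact off.2.2.2.2.2.2.2.2.1 h.symm
      · exact h.2 (Or.inr (Or.inr (Or.inl rfl)))
    · rw [e3] at hx1
      rcases hx1 with h | h | h
      · exact off.2.2.2.2.2.2.2.2.2.1 h
      · exact off1.2.2.2.2.2.2.2.2.1 (by rw [e2, e5]; exact h)
      · exact h.2 (Or.inr (Or.inr (Or.inr (Or.inr rfl))))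
    · rcases hx1 with h | h | ⟨h, -⟩
      · exact hxL (Or.inl (by rw [← h]; ring))
      · exact hxL (Or.inr (Or.inr (Or.inl (by linear_combination h))))
      · exact hI x hx h
  · intro x hx
    simp only [Finset.mem_insert, Finset.mem_sdiff] at hx
    rcases hx with rfl | rfl | ⟨hx, -⟩
    exacts [h0, h2, hIA hx]
  · rw [Finset.card_insert_of_notMem, Finset.card_insert_of_notMem]
    · have := Finset.card_sdiff_add_card_inter I L
      omega
    · simp [hL]
    · simp only [Finset.mem_insert, Finset.mem_sdiff, hL]
      rintro (h | h)
      · exact off.2.2.2.1 h.symm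
      · exact h.2 (Or.inr (Or.inl trivial))
  · simp
  · simp [e2]

theorem Indep.exists_maximal (hM : 4 ≤ M) {A J : Finset (ZMod M)} (hJ : Indep J) (hJA : J ⊆ A) :
    ∃ K, Indep K ∧ J ⊆ K ∧ K ⊆ A ∧ ∀ a ∈ A, a - 1 ∈ K ∨ a ∈ K ∨ a + 1 ∈ K := by
  classical
  obtain ⟨K, hK, hmax⟩ := Finset.exists_max_image
    (A.powerset.filter fun K => Indep K ∧ J ⊆ K) Finset.card
    ⟨J, by simp [hJ, hJA]⟩
  simp only [Finset.mem_filter, Finset.mem_powerset] at hK hmax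
  obtain ⟨hKA, hKi, hJK⟩ := hK
  refine ⟨K, hKi, hJK, hKA, fun a ha => ?_⟩
  by_contra hcon
  push Not at hcon
  obtain ⟨ha1, ha0, ha2⟩ := hcon
  have h1 := (offsets_ne hM a).2.1
  have hins : Indep (insert a K) := by
    intro x hx hx1
    rcases Finset.mem_insert.1 hx with rfl | hx
    · rcases Finset.mem_insert.1 hx1 with h | h
      · exact h1 h
      · exact ha2 h
    · rcases Finset.mem_insert.1 hx1 with h | h
      · exact ha1 (by rw [← h]; simpa using hx)
      · exact hKi x hx h
  have := hmax (insert a K) ⟨Finset.insert_subset ha hKA, hins,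
    hJK.trans (Finset.subset_insert _ _)⟩
  rw [Finset.card_insert_of_notMem ha0] at this
  omega

/-- One particle at each site of `J`. -/
def ind (J : Finset (ZMod M)) : Config M := fun i => if i ∈ J then 1 else 0

theorem ind_insert {J : Finset (ZMod M)} {i : ZMod M} (hi : i ∉ J) :
    ind (insert i J) = ind J + Pi.single i 1 := by
  funext x
  by_cases hx : x = i
  · subst hx; simp [ind, hi]
  · simp [ind, hx]

theorem potential_ind (hM : 4 ≤ M) (J : Finset (ZMod M)) (i : ZMod M) :
    potential (ind J) i =
      (if i - 1 ∈ J then 1 else 0) + (if i ∈ J then 1 else 0) + if i + 1 ∈ J then 1 else 0 :=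
  potential_eq hM _ i

/-- Filling a maximal independent set `J` of sites of minimal potential ends the round. -/
theorem minPotential_add_ind (hM : 4 ≤ M) {c : Config M} {J : Finset (ZMod M)} (hJ : Indep J)
    (hJA : J ⊆ minSites c)
    (hmax : ∀ a ∈ minSites c, a - 1 ∈ J ∨ a ∈ J ∨ a + 1 ∈ J) :
    minPotential (c + ind J) = minPotential c + 1 ∧ J ⊆ minSites (c + ind J) := by
  have hge : minPotential c + 1 ≤ minPotential (c + ind J) := by
    refine le_minPotential fun i => ?_
    rw [potential_add, potential_ind hM]
    by_cases hi : i ∈ minSites c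
    · rw [mem_minSites.1 hi]
      rcases hmax i hi with h | h | h
      · rw [if_pos h]; omega
      · rw [if_pos h]; omega
      · rw [if_pos h]; omega
    · have : minPotential c ≠ potential c i := fun e => hi (mem_minSites.2 e.symm)
      have := minPotential_le c i
      omega
  have hpot : ∀ i ∈ J, potential (c + ind J) i = minPotential c + 1 := by
    intro i hi
    have h1 := hJ i hi
    have h2 : i - 1 ∉ J := fun h => hJ _ h (by simpa using hi)
    rw [potential_add, potential_ind hM, if_pos hi, if_neg h1, if_neg h2,
      mem_minSites.1 (hJA hi)]
  have hne : J.Nonempty := by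
    obtain ⟨a, ha⟩ := minSites_nonempty c
    rcases hmax a ha with h | h | h <;> exact ⟨_, h⟩
  obtain ⟨i, hi⟩ := hne
  have heq : minPotential (c + ind J) = minPotential c + 1 :=
    le_antisymm (hpot i hi ▸ minPotential_le _ i) hge
  exact ⟨heq, fun i hi => mem_minSites.2 (by rw [hpot i hi, heq])⟩

/-- The sites of `J` are pairwise non-adjacent, so each remains minimal until it is filled. Filling
`J` in any order is therefore a legal path, and each step costs a factor at most `M`. -/
theorem le_pow_mul_of_indep {g : Config M → ℝ}
    (hg : ∀ c, ∀ i ∈ minSites c, g (c + Pi.single i 1) ≤ M * g c) (hM : 4 ≤ M) (c : Config M)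
    (J : Finset (ZMod M)) :
    Indep J → J ⊆ minSites c → g (c + ind J) ≤ (M : ℝ) ^ J.card * g c := by
  induction J using Finset.induction_on with
  | empty =>
    intro _ _
    have : c + ind (∅ : Finset (ZMod M)) = c := by funext x; simp [ind]
    rw [this]; simp
  | insert i J hi ih =>
    intro hJ hJA
    have hJ' : Indep J := fun x hx h => hJ x (Finset.mem_insert_of_mem hx)
      (Finset.mem_insert_of_mem h)
    have h1 := ih hJ' ((Finset.subset_insert _ _).trans hJA)
    have hiA := hJA (Finset.mem_insert_self i J)
    have a1 : i + 1 ∉ J := fun h => hJ i (Finset.mem_insert_self _ _) (Finset.mem_insert_of_mem h)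
    have a2 : i - 1 ∉ J := fun h => hJ _ (Finset.mem_insert_of_mem h)
      (by rw [sub_add_cancel]; exact Finset.mem_insert_self _ _)
    have hpot : potential (c + ind J) i = minPotential c := by
      rw [potential_add, potential_ind hM, if_neg hi, if_neg a1, if_neg a2, mem_minSites.1 hiA, add_zero,
        add_zero, add_zero]
    have him : i ∈ minSites (c + ind J) := by
      refine mem_minSites.2 (le_antisymm ?_ (minPotential_le _ i))
      rw [hpot]
      refine le_minPotential fun x => ?_
      rw [potential_add]
      have := minPotential_le c x
      omega
    rw [ind_insert hi, ← add_assoc, Finset.card_insert_of_notMem hi, pow_succ']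
    calc g (c + ind J + Pi.single i 1) ≤ M * g (c + ind J) := hg _ i him
      _ ≤ M * ((M : ℝ) ^ J.card * g c) := by gcongr
      _ = _ := by ring

/-! ### Superharmonic functions are bounded below by their values on absorbing configurations -/

theorem card_minSites_le (c : Config M) : (minSites c).card ≤ M :=
  (Finset.card_le_univ _).trans_eq (ZMod.card M)

/-- A nonnegative function whose average over the possible steps does not exceed its value. -/
structure Superharmonic (g : Config M → ℝ) : Prop where
  nonneg : ∀ c, 0 ≤ g c
  average_le : ∀ c, ∑ i ∈ minSites c, g (c + Pi.single i 1) ≤ (minSites c).card * g c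

theorem Superharmonic.step_le {g : Config M → ℝ} (hg : Superharmonic g) (c : Config M) (i : ZMod M)
    (hi : i ∈ minSites c) : g (c + Pi.single i 1) ≤ M * g c :=
  calc g (c + Pi.single i 1) ≤ ∑ i ∈ minSites c, g (c + Pi.single i 1) :=
        Finset.single_le_sum (f := fun i => g (c + Pi.single i 1)) (fun _ _ => hg.nonneg _) hi
    _ ≤ (minSites c).card * g c := hg.average_le c
    _ ≤ M * g c := by
        have := hg.nonneg c
        have : ((minSites c).card : ℝ) ≤ M := by exact_mod_cast card_minSites_le c
        gcongr

/-- One value that falls short of the bound by `(1 - r) * b` pulls the average down by at least a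
fraction 1/M of this, as there are at most `M` choices. -/
theorem le_of_average_le {A : Finset (ZMod M)} {F : ZMod M → ℝ} {b r y : ℝ} (hb : 0 ≤ b)
    (hr : r ≤ 1) {p : ZMod M} (hp : p ∈ A) (hF : ∀ i ∈ A, F i ≤ b) (hFp : F p ≤ r * b)
    (hy : A.card * y ≤ ∑ i ∈ A, F i) : y ≤ (1 - (1 - r) / M) * b := by
  have hA : (0 : ℝ) < A.card := by exact_mod_cast Finset.card_pos.2 ⟨p, hp⟩
  have hAM : (A.card : ℝ) ≤ M := by
    exact_mod_cast (Finset.card_le_univ A).trans_eq (ZMod.card M)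
  have h1 : ∑ i ∈ A, (b - F i) ≥ b - F p :=
    Finset.single_le_sum (f := fun i => b - F i) (fun i hi => sub_nonneg.2 (hF i hi)) hp
  rw [Finset.sum_sub_distrib, Finset.sum_const, nsmul_eq_mul] at h1
  have h2 : (1 - r) * b ≤ A.card * (b - y) := by linarith
  have hby : 0 ≤ b - y := by
    by_contra h
    have : (A.card : ℝ) * (b - y) < 0 := mul_neg_of_pos_of_neg hA (not_le.1 h)
    have : 0 ≤ (1 - r) * b := mul_nonneg (by linarith) hb
    linarith
  have h3 : (1 - r) * b ≤ M * (b - y) := h2.trans (mul_le_mul_of_nonneg_right hAM hby)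
  have hMpos : (0 : ℝ) < M := hA.trans_le hAM
  have h4 : (1 - r) / M * b ≤ b - y := by
    rw [div_mul_eq_mul_div, div_le_iff₀ hMpos]; linarith
  linarith

/-- The neighbourhood of `s` contains `s'`, so each summand is at most the indicator of `s` minus
that of `s'`; these cancel because the two sites are minimal simultaneously. -/
theorem pair_drift {A : Finset (ZMod M)} {s s' : ZMod M} (hne : s ≠ s')
    (hadj : s' = s - 1 ∨ s' = s + 1) (hiff : s ∈ A ↔ s' ∈ A) :
    ∑ p ∈ A, (2 * (if p = s then 1 else 0) -
      (if p = s - 1 ∨ p = s ∨ p = s + 1 then 1 else 0) : ℝ) ≤ 0 := by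
  have h1 : ∑ p ∈ A, (2 * (if p = s then 1 else 0) -
      (if p = s - 1 ∨ p = s ∨ p = s + 1 then 1 else 0) : ℝ) ≤
      ∑ p ∈ A, ((if p = s then 1 else 0) - (if p = s' then 1 else 0) : ℝ) := by
    refine Finset.sum_le_sum fun p _ => ?_
    by_cases h : p = s
    · subst h
      simp [hne]
      norm_num
    · rw [if_neg h]
      by_cases h' : p = s'
      · rw [if_pos h', if_pos (by rw [h']; tauto)]; norm_num
      · rw [if_neg h']
        split_ifs <;> norm_num
  refine h1.trans ?_
  rw [Finset.sum_sub_distrib, Finset.sum_ite_eq', Finset.sum_ite_eq']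
  simp [hiff]

/-- Maximum principle: a bounded function that is at most its average over the possible steps while
`R` holds, that is nonpositive on leaving `R`, and from whose positivity set one can leave `R`
within a bounded number of steps, is nonpositive. -/
theorem nonpos_of_contracting {R : Config M → Prop} {f : Config M → ℝ} {W : Config M → ℕ} {β : ℝ}
    {N : ℕ} (hβ : 0 ≤ β) (hfβ : ∀ c, R c → f c ≤ β)
    (hfavg : ∀ c, R c → (minSites c).card * f c ≤ ∑ p ∈ minSites c, f (c + Pi.single p 1))
    (hfexit : ∀ c, R c → ∀ p ∈ minSites c, ¬ R (c + Pi.single p 1) → f (c + Pi.single p 1) ≤ 0)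
    (hpath : ∀ c, R c → ∃ p ∈ minSites c, W (c + Pi.single p 1) < W c)
    (hN : ∀ c, R c → 0 < f c → W c ≤ N) (c : Config M) (hc : R c) : f c ≤ 0 := by
  have hM1 : (1 : ℝ) ≤ M := by exact_mod_cast NeZero.one_le
  have hMpos : (0 : ℝ) < M := by linarith
  have hpow : ∀ n : ℕ, 0 < (1 / M : ℝ) ^ n ∧ (1 / M : ℝ) ^ n ≤ 1 := fun n =>
    ⟨by positivity, pow_le_one₀ (by positivity) ((div_le_one hMpos).2 hM1)⟩
  -- A path along which `W` decreases must leave `R` within `n + 1` steps. Each step is chosen with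
  -- probability at least 1/M, so a fraction of the bound is lost.
  have hcontract : ∀ b : ℝ, 0 ≤ b → (∀ c, R c → f c ≤ b) → ∀ n c, R c → W c ≤ n →
      f c ≤ (1 - (1 / M : ℝ) ^ (n + 1)) * b := by
    intro b hb0 hfb n
    induction n with
    | zero =>
      intro c hc hW
      obtain ⟨p, -, h⟩ := hpath c hc
      omega
    | succ n ih =>
      intro c hc hW
      obtain ⟨p, hp, hlt⟩ := hpath c hc
      obtain ⟨h0, h1⟩ := hpow (n + 1)
      have := le_of_average_le (F := fun p => f (c + Pi.single p 1)) hb0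
        (r := 1 - (1 / M : ℝ) ^ (n + 1)) (by linarith) hp (fun i hi => ?_) ?_ (hfavg c hc)
      · refine this.trans_eq ?_
        rw [pow_succ _ (n + 1)]
        ring
      · by_cases h : R (c + Pi.single i 1)
        · exact hfb _ h
        · exact (hfexit c hc i hi h).trans hb0
      · by_cases h : R (c + Pi.single p 1)
        · exact ih _ h (by omega)
        · exact (hfexit c hc p hp h).trans (mul_nonneg (by linarith) hb0)
  obtain ⟨hN0, hN1⟩ := hpow (N + 1)
  set θ : ℝ := 1 - (1 / M : ℝ) ^ (N + 1) with hθ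
  have hθ0 : 0 ≤ θ := by linarith
  have hiter : ∀ k : ℕ, ∀ c, R c → f c ≤ θ ^ k * β := by
    intro k
    induction k with
    | zero => simpa using hfβ
    | succ k ih =>
      intro c hc
      by_cases h : 0 < f c
      · refine (hcontract _ (by positivity) ih N c hc (hN c hc h)).trans_eq ?_
        rw [← hθ, pow_succ]
        ring
      · exact (not_lt.1 h).trans (by positivity)
  have hlim : Tendsto (fun k : ℕ => θ ^ k * β) atTop (𝓝 (0 * β)) :=
    (tendsto_pow_atTop_nhds_zero_of_lt_one hθ0 (by linarith)).mul_const β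
  rw [zero_mul] at hlim
  exact ge_of_tendsto' hlim fun k => hiter k c hc

/-- While the configuration stays tame, a site with no isolated neighbour comes down to the
minimal level; hence a superharmonic function inherits a lower bound from the exit. -/
theorem Superharmonic.le_of_exit (hM : 4 ≤ M) {g : Config M → ℝ} (hg : Superharmonic g)
    {P : Finset (ZMod M)} {j : ZMod M} (hj : j ∉ P) (hl : ¬ Iso P (j - 1)) (hr : ¬ Iso P (j + 1))
    {β : ℝ} (hβ : 0 ≤ β)
    (hexit : ∀ c, Tame P c → ∀ p ∈ minSites c, ¬ Tame P (c + Pi.single p 1) →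
      β ≤ g (c + Pi.single p 1)) (c₀ : Config M) (hc₀ : Tame P c₀) : β ≤ g c₀ := by
  have off := offsets_ne hM j
  have hMpos : (0 : ℝ) < M := by exact_mod_cast (by omega : 0 < M)
  obtain ⟨q, hq⟩ : P.Nonempty := by
    obtain ⟨p, hp⟩ := minSites_nonempty c₀
    exact ⟨p, hc₀.mem hp⟩
  have el1 : j - 1 - 1 = j - 2 := by ring
  have el2 : j - 1 + 1 = j := by ring
  have er1 : j + 1 + 1 = j + 2 := by ring
  have er2 : j + 1 - 1 = j := by ring
  have hl' : j - 1 ∈ P → j - 2 ∈ P := fun h => by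
    by_contra h'
    exact hl ⟨h, by rwa [el1], by rwa [el2]⟩
  have hr' : j + 1 ∈ P → j + 2 ∈ P := fun h => by
    by_contra h'
    exact hr ⟨h, by rwa [er2], by rwa [er1]⟩
  have hml : ∀ c, Tame P c → j - 1 ∈ P → (j - 1 ∈ minSites c ↔ j - 2 ∈ minSites c) := by
    intro c hc h
    have := hc.eq (j - 2) (hl' h) (by convert h using 1; ring)
    have e : j - 2 + 1 = j - 1 := by ring
    rw [mem_minSites, mem_minSites, this, e]
  have hmr : ∀ c, Tame P c → j + 1 ∈ P → (j + 1 ∈ minSites c ↔ j + 2 ∈ minSites c) := by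
    intro c hc h
    have := hc.eq (j + 1) h (by rw [er1]; exact hr' h)
    rw [mem_minSites, mem_minSites, this, er1]
  -- If `j - 1` is outside `P` it never receives a particle while the configuration is tame, and any
  -- site `q` of `P` serves as reference. The same holds for `b` on the right.
  obtain ⟨a, haP, ha⟩ : ∃ a ∈ P, j - 1 ∈ P → a = j - 1 := by
    by_cases h : j - 1 ∈ P
    · exact ⟨j - 1, h, fun _ => rfl⟩
    · exact ⟨q, hq, fun h' => absurd h' h⟩
  obtain ⟨b, hbP, hb⟩ : ∃ b ∈ P, j + 1 ∈ P → b = j + 1 := by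
    by_cases h : j + 1 ∈ P
    · exact ⟨j + 1, h, fun _ => rfl⟩
    · exact ⟨q, hq, fun h' => absurd h' h⟩
  -- A Lyapunov function: twice the height of `j` above the mean of its two reference sites. While
  -- the configuration is tame, `j` rises only through `j - 1` and `j + 1`, so the drift of `V` is a
  -- sum of two terms handled by `pair_drift`.
  let V : Config M → ℝ := fun c => 2 * potential c j - potential c a - potential c b
  have hVdrift : ∀ c, Tame P c →
      ∑ p ∈ minSites c, V (c + Pi.single p 1) ≤ (minSites c).card * V c := by
    intro c hc
    have hdl : ∑ p ∈ minSites c, (2 * (if p = j - 1 then 1 else 0) -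
        (if p = a - 1 ∨ p = a ∨ p = a + 1 then 1 else 0) : ℝ) ≤ 0 := by
      by_cases h : j - 1 ∈ P
      · rw [ha h]
        exact pair_drift off.2.2.2.2.2.1.symm (Or.inl el1.symm) (hml c hc h)
      · refine Finset.sum_nonpos fun p hp => ?_
        have hne : p ≠ j - 1 := fun e => h (e ▸ hc.mem hp)
        rw [if_neg hne]
        split_ifs <;> norm_num
    have hdr : ∑ p ∈ minSites c, (2 * (if p = j + 1 then 1 else 0) -
        (if p = b - 1 ∨ p = b ∨ p = b + 1 then 1 else 0) : ℝ) ≤ 0 := by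
      by_cases h : j + 1 ∈ P
      · rw [hb h]
        exact pair_drift off.2.2.2.2.2.2.2.2.1.symm (Or.inr er1.symm) (hmr c hc h)
      · refine Finset.sum_nonpos fun p hp => ?_
        have hne : p ≠ j + 1 := fun e => h (e ▸ hc.mem hp)
        rw [if_neg hne]
        split_ifs <;> norm_num
    have hstep : ∀ p ∈ minSites c, V (c + Pi.single p 1) = V c +
        ((2 * (if p = j - 1 then 1 else 0) -
          (if p = a - 1 ∨ p = a ∨ p = a + 1 then 1 else 0)) +
        (2 * (if p = j + 1 then 1 else 0) -
          (if p = b - 1 ∨ p = b ∨ p = b + 1 then 1 else 0))) := by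
      intro p hp
      have hpj : p ≠ j := fun e => hj (e ▸ hc.mem hp)
      have hsplit : ((if p = j - 1 ∨ p = j ∨ p = j + 1 then 1 else 0 : ℕ) : ℝ) =
          (if p = j - 1 then 1 else 0) + (if p = j + 1 then 1 else 0) := by
        by_cases e1 : p = j - 1
        · rw [if_pos (Or.inl e1), if_pos e1, if_neg (by rw [e1]; exact off.2.2.2.2.1)]; norm_num
        · by_cases e2 : p = j + 1
          · rw [if_pos (Or.inr (Or.inr e2)), if_neg e1, if_pos e2]; norm_num
          · rw [if_neg (by rintro (h | h | h); exacts [e1 h, hpj h, e2 h]), if_neg e1, if_neg e2]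
            norm_num
      simp only [V, potential_step]
      rw [Nat.cast_add, hsplit]
      push_cast
      ring
    rw [Finset.sum_congr rfl hstep, Finset.sum_add_distrib, Finset.sum_add_distrib,
      Finset.sum_const, nsmul_eq_mul]
    linarith
  have hVnonneg : ∀ c, Tame P c → ∀ p ∈ minSites c, 0 ≤ V (c + Pi.single p 1) := by
    intro c hc p hp
    have hup : ∀ x ∈ P, potential (c + Pi.single p 1) x ≤ minPotential c + 1 := by
      exact fun x hx => hc.potential_step_le hp hx
    have h1 := hup a haP
    have h2 := hup b hbP
    have h3 := hc.gt j hj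
    have h4 : potential c j ≤ potential (c + Pi.single p 1) j := by rw [potential_step]; omega
    have h1' : (potential (c + Pi.single p 1) a : ℝ) ≤ potential (c + Pi.single p 1) j := by
      exact_mod_cast (by omega)
    have h2' : (potential (c + Pi.single p 1) b : ℝ) ≤ potential (c + Pi.single p 1) j := by
      exact_mod_cast (by omega)
    simp only [V]
    linarith
  -- Natural subtraction does not truncate on tame configurations: there the sites of `P` are never
  -- above `j`.
  let W : Config M → ℕ := fun c => ∑ x ∈ P, (potential c j - potential c x)
  have hWV : ∀ c, Tame P c → (W c : ℝ) ≤ M * (V c + 1) := by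
    intro c hc
    have h1 : ∀ x ∈ P, potential c j - potential c x ≤ potential c j - minPotential c := by
      intro x _
      have := minPotential_le c x
      omega
    have h2 : W c ≤ M * (potential c j - minPotential c) := by
      refine (Finset.sum_le_card_nsmul _ _ _ h1).trans ?_
      rw [smul_eq_mul]
      exact Nat.mul_le_mul_right _ ((Finset.card_le_univ P).trans_eq (ZMod.card M))
    have h3 : ((potential c j - minPotential c : ℕ) : ℝ) ≤ V c + 1 := by
      have k1 := hc.le a haP
      have k2 := hc.le b hbP
      have k3 := hc.gt j hj
      rw [Nat.cast_sub k3.le]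
      have k1' : (potential c a : ℝ) ≤ minPotential c + 1 := by exact_mod_cast k1
      have k2' : (potential c b : ℝ) ≤ minPotential c + 1 := by exact_mod_cast k2
      have k3' : (minPotential c : ℝ) + 1 ≤ potential c j := by exact_mod_cast k3
      simp only [V]
      linarith
    calc (W c : ℝ) ≤ M * ((potential c j - minPotential c : ℕ) : ℝ) := by exact_mod_cast h2
      _ ≤ M * (V c + 1) := by gcongr
  have hpath : ∀ c, Tame P c → ∃ p ∈ minSites c, W (c + Pi.single p 1) < W c := by
    intro c hc
    -- A minimal neighbour of `j` is half of a pair, and the other half is minimal too. Choosing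
    -- that one raises the level of `P` without raising `j`.
    obtain ⟨p, hp, hp1, hp2⟩ : ∃ p ∈ minSites c, p ≠ j - 1 ∧ p ≠ j + 1 := by
      obtain ⟨p, hp⟩ := minSites_nonempty c
      by_cases e1 : p = j - 1
      · subst e1
        exact ⟨j - 2, (hml c hc (hc.mem hp)).1 hp, off.2.2.2.2.2.1, off.2.2.2.2.2.2.1⟩
      · by_cases e2 : p = j + 1
        · subst e2
          exact ⟨j + 2, (hmr c hc (hc.mem hp)).1 hp, off.2.2.2.2.2.2.2.1, off.2.2.2.2.2.2.2.2.1⟩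
        · exact ⟨p, hp, e1, e2⟩
    have hpP := hc.mem hp
    have hpj : p ≠ j := fun e => hj (e ▸ hpP)
    have hj' : potential (c + Pi.single p 1) j = potential c j := by
      rw [potential_step, if_neg, add_zero]
      rintro (h | h | h)
      exacts [hp1 h, hpj h, hp2 h]
    refine ⟨p, hp, Finset.sum_lt_sum (fun x _ => ?_) ⟨p, hpP, ?_⟩⟩
    · rw [hj', potential_step]; omega
    · have h1 := hc.gt j hj
      rw [hj', potential_step, mem_minSites.1 hp, if_pos (Or.inr (Or.inl rfl))]
      omega
  have hVnonneg' : ∀ c, Tame P c → 0 ≤ V c := by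
    intro c hc
    have k1 : (potential c a : ℝ) ≤ potential c j := by
      exact_mod_cast (hc.le a haP).trans (hc.gt j hj)
    have k2 : (potential c b : ℝ) ≤ potential c j := by
      exact_mod_cast (hc.le b hbP).trans (hc.gt j hj)
    simp only [V]
    linarith
  -- Subtracting `δ * V` confines the positivity set to bounded `V`, hence bounded `W`, where the
  -- maximum principle applies. Then `δ` tends to 0.
  have hδ : ∀ δ : ℝ, 0 < δ → β - g c₀ - δ * V c₀ ≤ 0 := by
    intro δ hδ
    obtain ⟨N, hN⟩ := exists_nat_ge (M * (β / δ + 1) : ℝ)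
    refine nonpos_of_contracting (R := Tame P) (f := fun c => β - g c - δ * V c) (W := W) (β := β)
      (N := N) hβ (fun c hc => ?_) (fun c hc => ?_) (fun c hc p hp hn => ?_) hpath
      (fun c hc hpos => ?_) c₀ hc₀
    · have h1 := hg.nonneg c
      have h2 := mul_nonneg hδ.le (hVnonneg' c hc)
      linarith
    · have h1 := hg.average_le c
      have h2 := mul_le_mul_of_nonneg_left (hVdrift c hc) hδ.le
      simp only [Finset.sum_sub_distrib, Finset.sum_const, nsmul_eq_mul, ← Finset.mul_sum]
      linarith
    · have h1 := hexit c hc p hp hn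
      have h2 := mul_nonneg hδ.le (hVnonneg c hc p hp)
      linarith
    · have h1 := hg.nonneg c
      have h2 : V c ≤ β / δ := by
        rw [le_div_iff₀ hδ]
        linarith
      have h3 : (W c : ℝ) ≤ N :=
        (hWV c hc).trans ((mul_le_mul_of_nonneg_left (by linarith) hMpos.le).trans hN)
      exact_mod_cast h3
  have hlim : Tendsto (fun δ : ℝ => β - g c₀ - δ * V c₀) (𝓝[>] 0) (𝓝 (β - g c₀ - 0 * V c₀)) := by
    refine Tendsto.mono_left (Continuous.tendsto ?_ 0) nhdsWithin_le_nhds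
    fun_prop
  have := le_of_tendsto hlim (eventually_nhdsWithin_of_forall fun δ h => hδ δ h)
  linarith

/-- A superharmonic function that is at least one on all absorbing configurations is bounded below
by a positive constant which depends on `M` only. -/
theorem exists_lower_bound (hM : 4 ≤ M) : ∃ ε : ℝ, 0 < ε ∧ ∀ g : Config M → ℝ, Superharmonic g →
    (∀ P c, Guarded P → Tame P c → 1 ≤ g c) → ∀ c, ε ≤ g c := by
  have hM1 : (1 : ℝ) ≤ M := by exact_mod_cast NeZero.one_le
  -- Induction on the shortfall `d` of an independent set of minimal sites, whose size is at most
  -- `M`; with `d = M + 1` the empty set is enough.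
  have main : ∀ d : ℕ, ∃ ε : ℝ, 0 < ε ∧ ∀ g : Config M → ℝ, Superharmonic g →
      (∀ P c, Guarded P → Tame P c → 1 ≤ g c) →
      ∀ c, (∃ I, Indep I ∧ I ⊆ minSites c ∧ M + 1 ≤ I.card + d) → ε ≤ g c := by
    intro d
    induction d with
    | zero =>
      refine ⟨1, one_pos, fun g _ _ c ⟨I, _, _, hI⟩ => ?_⟩
      have := (Finset.card_le_univ I).trans_eq (ZMod.card M)
      omega
    | succ d ihd =>
      obtain ⟨ε₀, hε₀, H₀⟩ := ihd
      -- At fixed shortfall, an inner induction on the number of minimal sites.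
      have inner : ∀ l : ℕ, ∃ ε : ℝ, 0 < ε ∧ ∀ g : Config M → ℝ, Superharmonic g →
          (∀ P c, Guarded P → Tame P c → 1 ≤ g c) →
          ∀ c, (∃ I, Indep I ∧ I ⊆ minSites c ∧ M + 1 ≤ I.card + (d + 1)) →
            (minSites c).card ≤ l → ε ≤ g c := by
        intro l
        induction l with
        | zero =>
          refine ⟨1, one_pos, fun g _ _ c _ h => ?_⟩
          have := minSites_card_pos c
          omega
        | succ l ihl =>
          obtain ⟨ε₁, hε₁, H₁⟩ := ihl
          refine ⟨min (min 1 ε₀) (min ε₀ ε₁ / (M : ℝ) ^ M), by positivity, ?_⟩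
          rintro g hg habs c ⟨I, hI, hIA, hcard⟩ hl
          by_cases hT : NoTriple (minSites c)
          · refine (min_le_left _ _).trans ?_
            have htame := tame_minSites hT
            by_cases hG : Guarded (minSites c)
            · exact (min_le_left _ _).trans (habs _ _ hG htame)
            · refine (min_le_right _ _).trans ?_
              simp only [Guarded, not_forall, not_or] at hG
              obtain ⟨j, hj, hj1, hj2⟩ := hG
              -- The bound at the exit from the pattern carries over to the present configuration;
              -- at the exit the new minimal site enlarges the independent set.
              refine hg.le_of_exit hM hj hj1 hj2 hε₀.le (fun c' hc' p hp hn => ?_) c htame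
              rcases hc'.step hp with h | ⟨hsub, x, hx, hxA, hx1, hx2⟩
              · exact absurd h hn
              · obtain ⟨J, hJ, hJs, hJc⟩ := hI.exists_larger hM hT hIA hx hx1 hx2
                refine H₀ g hg habs _ ⟨J, hJ, fun y hy => ?_, by omega⟩
                rcases Finset.mem_insert.1 (hJs hy) with rfl | h
                exacts [hxA, hsub h]
          · refine (min_le_right _ _).trans ?_
            simp only [NoTriple, not_forall, not_not] at hT
            obtain ⟨a, ha, ha1, ha2⟩ := hT
            obtain ⟨J, hJ, hJA, hJc, b, hbA, hb1, hb2⟩ := hI.exists_double hM hIA ha ha1 ha2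
            obtain ⟨K, hK, hJK, hKA, hKmax⟩ := hJ.exists_maximal hM hJA
            have hKc : I.card ≤ K.card := hJc.trans (Finset.card_le_card hJK)
            obtain ⟨hmin, hKA'⟩ := minPotential_add_ind hM hK hKA hKmax
            have hpow := le_pow_mul_of_indep hg.step_le hM c K hK hKA
            have hKM : K.card ≤ M := (Finset.card_le_univ K).trans_eq (ZMod.card M)
            have hgc : g (c + ind K) ≤ (M : ℝ) ^ M * g c := by
              have := hg.nonneg c
              exact hpow.trans (by gcongr)
            have hlow : min ε₀ ε₁ ≤ g (c + ind K) := by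
              -- After filling `K`, either an old non-minimal site has become minimal, which means
              -- that it was untouched by `K` and can be added to it, or the minimal set has lost at
              -- least the site `b`.
              by_cases hnew : ∃ j ∈ minSites (c + ind K), j ∉ minSites c
              · refine (min_le_left _ _).trans ?_
                obtain ⟨j, hj, hjA⟩ := hnew
                have h1 := mem_minSites.1 hj
                rw [potential_add, potential_ind hM, hmin] at h1
                have h2 : minPotential c ≠ potential c j := fun e => hjA (mem_minSites.2 e.symm)
                have h3 := minPotential_le c j
                have k1 : j - 1 ∉ K := fun h => by rw [if_pos h] at h1; omega
                have k2 : j ∉ K := fun h => by rw [if_pos h] at h1; omega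
                have k3 : j + 1 ∉ K := fun h => by rw [if_pos h] at h1; omega
                refine H₀ g hg habs _ ⟨insert j K, ?_, ?_, ?_⟩
                · intro x hx hx1
                  rcases Finset.mem_insert.1 hx with rfl | hx
                  · rcases Finset.mem_insert.1 hx1 with h | h
                    · exact (offsets_ne hM x).2.1 h
                    · exact k3 h
                  · rcases Finset.mem_insert.1 hx1 with h | h
                    · exact k1 (by rw [← h]; simpa using hx)
                    · exact hK x hx h
                · exact Finset.insert_subset hj hKA'
                · rw [Finset.card_insert_of_notMem k2]
                  omega
              · refine (min_le_right _ _).trans ?_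
                push Not at hnew
                refine H₁ g hg habs _ ⟨K, hK, hKA', by omega⟩ ?_
                have hsub : minSites (c + ind K) ⊆ (minSites c).erase b := by
                  intro x hx
                  refine Finset.mem_erase.2 ⟨?_, hnew x hx⟩
                  rintro rfl
                  have h1 := mem_minSites.1 hx
                  rw [potential_add, potential_ind hM, hmin, if_pos (hJK hb1), if_pos (hJK hb2),
                    mem_minSites.1 hbA] at h1
                  omega
                have := Finset.card_le_card hsub
                rw [Finset.card_erase_of_mem hbA] at this
                omega
            rw [div_le_iff₀ (by positivity)]
            linarith
      obtain ⟨ε, hε, H⟩ := inner M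
      exact ⟨ε, hε, fun g hg habs c hc => H g hg habs c hc (card_minSites_le c)⟩
  obtain ⟨ε, hε, H⟩ := main (M + 1)
  refine ⟨ε, hε, fun g hg habs c => H g hg habs c ⟨∅, ?_, ?_, ?_⟩⟩
  · intro x hx
    simp at hx
  · simp
  · simp

/-- A bounded nonnegative function that is at most its average over the possible steps, and that
vanishes on the absorbing configurations, vanishes everywhere. -/
theorem eq_zero_of_subharmonic (hM : 4 ≤ M) {h : Config M → ℝ} (h0 : ∀ c, 0 ≤ h c)
    (h1 : ∀ c, h c ≤ 1)
    (havg : ∀ c, (minSites c).card * h c ≤ ∑ i ∈ minSites c, h (c + Pi.single i 1))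
    (habs : ∀ P c, Guarded P → Tame P c → h c = 0) (c : Config M) : h c = 0 := by
  obtain ⟨ε, hε, H⟩ := exists_lower_bound (M := M) hM
  have hiter : ∀ k : ℕ, ∀ c, h c ≤ (1 - min ε (1 / 2)) ^ k := by
    intro k
    induction k with
    | zero => simpa using h1
    | succ k ih =>
      intro c
      set b := (1 - min ε (1 / 2)) ^ k with hb
      have hθ : 0 < 1 - min ε (1 / 2) := by
        have := min_le_right ε (1 / 2 : ℝ)
        linarith
      have hb0 : 0 < b := by positivity
      -- The normalised deficit from the current bound `b` equals 1 on absorbing configurations, so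
      -- it is at least `ε` everywhere. The uniformity of `ε` in the function allows iteration; the
      -- cap 1/2 keeps `b` positive.
      have hS : Superharmonic fun c => (b - h c) / b := by
        refine ⟨fun c => div_nonneg (sub_nonneg.2 (ih c)) hb0.le, fun c => ?_⟩
        rw [← Finset.sum_div, Finset.sum_sub_distrib, Finset.sum_const, nsmul_eq_mul, ← mul_div_assoc]
        have := havg c
        gcongr
        linarith
      have := H _ hS (fun P c hP hc => by rw [habs P c hP hc, sub_zero, div_self hb0.ne']) c
      rw [le_div_iff₀ hb0] at this
      have h2 : min ε (1 / 2) * b ≤ ε * b := by gcongr; exact min_le_left _ _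
      rw [pow_succ, ← hb]
      linarith
  have hpos : 0 < min ε (1 / 2) := by positivity
  have hle : min ε (1 / 2 : ℝ) ≤ 1 / 2 := min_le_right _ _
  have hlim := tendsto_pow_atTop_nhds_zero_of_lt_one (r := 1 - min ε (1 / 2))
    (by linarith) (by linarith)
  exact le_antisymm (ge_of_tendsto' hlim fun k => hiter k c) (h0 c)

/-! ### The two sites of a pair share their particles evenly -/

/-- By the addition formulas the two sites of the pair contribute opposite `sinh` terms, which
cancel since both or neither are in `A`. Steps elsewhere cost nothing because `cosh r` is at least
1. -/
theorem sum_cosh_le {A : Finset (ZMod M)} {a : ZMod M} (hne : a + 1 ≠ a)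
    (hiff : a ∈ A ↔ a + 1 ∈ A) (c : Config M) (r : ℝ) :
    ∑ p ∈ A, Real.cosh (r * (((c + Pi.single p 1 : Config M) a : ℝ) -
        (c + Pi.single p 1 : Config M) (a + 1))) ≤
      A.card * (Real.cosh r * Real.cosh (r * ((c a : ℝ) - c (a + 1)))) := by
  set D : ℝ := (c a : ℝ) - c (a + 1) with hD
  have hC : 1 ≤ Real.cosh r := Real.one_le_cosh r
  have hterm : ∀ p ∈ A, Real.cosh (r * (((c + Pi.single p 1 : Config M) a : ℝ) -
        (c + Pi.single p 1 : Config M) (a + 1))) ≤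
      Real.cosh r * Real.cosh (r * D) + ((if p = a then 1 else 0) * (Real.sinh r * Real.sinh (r * D))
        - (if p = a + 1 then 1 else 0) * (Real.sinh r * Real.sinh (r * D))) := by
    intro p _
    by_cases h1 : p = a
    · subst h1
      have e : r * (((c + Pi.single p 1 : Config M) p : ℝ) -
        (c + Pi.single p 1 : Config M) (p + 1)) = r + r * D := by
        simp [hD, hne]; ring
      rw [e, Real.cosh_add, if_pos rfl, if_neg (Ne.symm hne)]
      linarith
    · by_cases h2 : p = a + 1
      · subst h2
        have e : r * (((c + Pi.single (a + 1) 1 : Config M) a : ℝ) -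
          (c + Pi.single (a + 1) 1 : Config M) (a + 1)) = r * D - r := by
          simp [hD, hne]; ring
        rw [e, Real.cosh_sub, if_neg h1, if_pos rfl]
        linarith
      · have e : r * (((c + Pi.single p 1 : Config M) a : ℝ) -
          (c + Pi.single p 1 : Config M) (a + 1)) = r * D := by
          simp [hD, Ne.symm h1, Ne.symm h2]
        rw [e, if_neg h1, if_neg h2]
        have : 1 * Real.cosh (r * D) ≤ Real.cosh r * Real.cosh (r * D) :=
          mul_le_mul_of_nonneg_right hC (Real.cosh_pos _).le
        linarith
  refine (Finset.sum_le_sum hterm).trans_eq ?_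
  rw [Finset.sum_add_distrib, Finset.sum_const, nsmul_eq_mul, Finset.sum_sub_distrib,
    ← Finset.sum_mul, ← Finset.sum_mul, Finset.sum_ite_eq', Finset.sum_ite_eq']
  simp [hiff]

theorem lintegral_cosh_le (hM : 4 ≤ M) {P : Finset (ZMod M)} (hP : Guarded P) {a : ZMod M}
    (ha : a ∈ P) (ha1 : a + 1 ∈ P) (r : ℝ) (t : ℕ) : ∀ c, Tame P c →
    ∫⁻ ξ, ENNReal.ofReal (Real.cosh (r * ((ξ t a : ℝ) - ξ t (a + 1)))) ∂(law c) ≤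
      ENNReal.ofReal (Real.cosh r ^ t * Real.cosh (r * ((c a : ℝ) - c (a + 1)))) := by
  have hmeas : ∀ t : ℕ, Measurable fun ξ : ℕ → Config M =>
      ENNReal.ofReal (Real.cosh (r * ((ξ t a : ℝ) - ξ t (a + 1)))) := fun t =>
    (Measurable.of_discrete (f := fun c : Config M =>
      ENNReal.ofReal (Real.cosh (r * ((c a : ℝ) - c (a + 1)))))).comp (measurable_pi_apply t)
  induction t with
  | zero =>
    intro c _
    have : ∀ᵐ ξ ∂(law c), ENNReal.ofReal (Real.cosh (r * ((ξ 0 a : ℝ) - ξ 0 (a + 1)))) =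
        ENNReal.ofReal (Real.cosh (r * ((c a : ℝ) - c (a + 1)))) := by
      filter_upwards [law_zero_time c] with ξ hξ
      rw [hξ]
    rw [lintegral_congr_ae this]
    simp
  | succ t ih =>
    intro c hc
    have h := lintegral_shift c (hmeas t)
    have h' : ∫⁻ ξ, ENNReal.ofReal (Real.cosh (r * ((ξ (t + 1) a : ℝ) - ξ (t + 1) (a + 1))))
        ∂(law c) = ∫⁻ ξ, ENNReal.ofReal (Real.cosh (r * ((shift ξ t a : ℝ) - shift ξ t (a + 1))))
        ∂(law c) := rfl
    have hcard : (0 : ℝ) < (minSites c).card := by exact_mod_cast minSites_card_pos c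
    rw [h', h]
    calc _ ≤ ((minSites c).card : ENNReal)⁻¹ * ∑ i ∈ minSites c, ENNReal.ofReal
          (Real.cosh r ^ t * Real.cosh (r * (((c + Pi.single i 1 : Config M) a : ℝ) -
            (c + Pi.single i 1 : Config M) (a + 1)))) := by
          gcongr with i hi
          exact ih _ (hc.step_guarded hP hi)
      _ = ENNReal.ofReal ((minSites c).card : ℝ)⁻¹ * ENNReal.ofReal (∑ i ∈ minSites c,
          (Real.cosh r ^ t * Real.cosh (r * (((c + Pi.single i 1 : Config M) a : ℝ) -
            (c + Pi.single i 1 : Config M) (a + 1))))) := by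
          rw [ENNReal.ofReal_sum_of_nonneg, ENNReal.ofReal_inv_of_pos hcard, ENNReal.ofReal_natCast]
          intro i _
          have := Real.cosh_pos r
          have := Real.cosh_pos (r * (((c + Pi.single i 1 : Config M) a : ℝ) -
            (c + Pi.single i 1 : Config M) (a + 1)))
          positivity
      _ ≤ _ := by
          rw [← ENNReal.ofReal_mul (by positivity)]
          refine ENNReal.ofReal_le_ofReal ?_
          rw [← Finset.mul_sum, inv_mul_le_iff₀ hcard]
          have hiff : a ∈ minSites c ↔ a + 1 ∈ minSites c := by
            rw [mem_minSites, mem_minSites, hc.eq a ha ha1]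
          have h1 := sum_cosh_le (offsets_ne hM a).2.1 hiff c r
          have h2 := mul_le_mul_of_nonneg_left h1 (pow_pos (Real.cosh_pos r) t).le
          refine h2.trans_eq ?_
          rw [pow_succ]
          ring

/-- Markov's inequality for the `cosh` moment gives a geometrically small probability at time `t`;
Borel–Cantelli concludes. -/
theorem ae_eventually_difference_lt (hM : 4 ≤ M) {P : Finset (ZMod M)} (hP : Guarded P)
    {a : ZMod M} (ha : a ∈ P) (ha1 : a + 1 ∈ P) {c : Config M} (hc : Tame P c) {δ : ℝ}
    (hδ : 0 < δ) :
    ∀ᵐ ξ ∂(law c), ∀ᶠ t : ℕ in atTop, |(ξ t a : ℝ) - ξ t (a + 1)| < δ * t := by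
  set K : ℝ := 2 * Real.cosh (δ * ((c a : ℝ) - c (a + 1))) with hK
  have hK0 : 0 < K := by have := Real.cosh_pos (δ * ((c a : ℝ) - c (a + 1))); positivity
  have hbound : ∀ t : ℕ, law c {ξ | δ * t ≤ |(ξ t a : ℝ) - ξ t (a + 1)|} ≤
      ENNReal.ofReal (K * Real.exp (-(δ ^ 2 / 2)) ^ t) := by
    intro t
    have hmeas : Measurable fun ξ : ℕ → Config M =>
        ENNReal.ofReal (Real.cosh (δ * ((ξ t a : ℝ) - ξ t (a + 1)))) :=
      (Measurable.of_discrete (f := fun c : Config M =>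
        ENNReal.ofReal (Real.cosh (δ * ((c a : ℝ) - c (a + 1)))))).comp (measurable_pi_apply t)
    have hsub : {ξ : ℕ → Config M | δ * t ≤ |(ξ t a : ℝ) - ξ t (a + 1)|} ⊆
        {ξ | ENNReal.ofReal (Real.exp (δ * (δ * t)) / 2) ≤
          ENNReal.ofReal (Real.cosh (δ * ((ξ t a : ℝ) - ξ t (a + 1))))} := by
      intro ξ hξ
      refine ENNReal.ofReal_le_ofReal ?_
      have h1 : Real.exp (δ * (δ * t)) ≤ Real.exp |δ * ((ξ t a : ℝ) - ξ t (a + 1))| := by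
        rw [abs_mul, abs_of_pos hδ]
        exact Real.exp_le_exp.2 (mul_le_mul_of_nonneg_left hξ hδ.le)
      rw [← Real.cosh_abs, Real.cosh_eq]
      have := Real.exp_pos (-|δ * ((ξ t a : ℝ) - ξ t (a + 1))|)
      linarith
    have hpos : 0 < Real.exp (δ * (δ * t)) / 2 := by positivity
    refine (measure_mono hsub).trans ?_
    refine (meas_ge_le_lintegral_div hmeas.aemeasurable (by simpa using hpos)
      ENNReal.ofReal_ne_top).trans ?_
    -- With parameter `δ`, the moment grows at most like exp(δ²t/2) against exp(δ²t) in the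
    -- denominator, which leaves the rate exp(-δ²/2).
    refine (ENNReal.div_le_div_right (lintegral_cosh_le hM hP ha ha1 δ t c hc) _).trans ?_
    rw [← ENNReal.ofReal_div_of_pos hpos]
    refine ENNReal.ofReal_le_ofReal ?_
    rw [div_le_iff₀ hpos]
    have h1 : Real.cosh δ ^ t ≤ Real.exp (δ ^ 2 / 2) ^ t :=
      pow_le_pow_left₀ (Real.cosh_pos δ).le (Real.cosh_le_exp_half_sq δ) t
    have h2 : Real.exp (-(δ ^ 2 / 2)) ^ t * Real.exp (δ * (δ * t)) = Real.exp (δ ^ 2 / 2) ^ t := by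
      rw [← Real.exp_nat_mul, ← Real.exp_nat_mul, ← Real.exp_add]
      congr 1
      ring
    calc Real.cosh δ ^ t * Real.cosh (δ * ((c a : ℝ) - c (a + 1)))
        ≤ Real.exp (δ ^ 2 / 2) ^ t * Real.cosh (δ * ((c a : ℝ) - c (a + 1))) :=
          mul_le_mul_of_nonneg_right h1 (Real.cosh_pos _).le
      _ = _ := by rw [← h2, hK]; ring
  have hsum : ∑' t : ℕ, law c {ξ | δ * t ≤ |(ξ t a : ℝ) - ξ t (a + 1)|} ≠ ⊤ := by
    refine ne_top_of_le_ne_top ?_ (ENNReal.tsum_le_tsum hbound)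
    have hs : Summable fun t : ℕ => K * Real.exp (-(δ ^ 2 / 2)) ^ t := by
      refine (summable_geometric_of_lt_one (Real.exp_pos _).le ?_).mul_left K
      rw [Real.exp_lt_one_iff]
      have : 0 < δ ^ 2 := by positivity
      linarith
    exact hs.tsum_ofReal_ne_top
  filter_upwards [ae_eventually_notMem hsum] with ξ hξ
  filter_upwards [hξ] with t ht
  exact not_le.1 ht

theorem ae_tendsto_difference (hM : 4 ≤ M) {P : Finset (ZMod M)} (hP : Guarded P)
    {a : ZMod M} (ha : a ∈ P) (ha1 : a + 1 ∈ P) {c : Config M} (hc : Tame P c) :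
    ∀ᵐ ξ ∂(law c), Tendsto (fun t : ℕ => ((ξ t a : ℝ) - ξ t (a + 1)) / t) atTop (𝓝 0) := by
  have h : ∀ᵐ ξ ∂(law c), ∀ k : ℕ, ∀ᶠ t : ℕ in atTop,
      |(ξ t a : ℝ) - ξ t (a + 1)| < 1 / ((k : ℝ) + 1) * t :=
    ae_all_iff.2 fun k => ae_eventually_difference_lt hM hP ha ha1 hc (by positivity)
  filter_upwards [h] with ξ hξ
  rw [Metric.tendsto_atTop']
  intro ε hε
  obtain ⟨k, hk⟩ := exists_nat_one_div_lt hε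
  obtain ⟨T, hT⟩ := eventually_atTop.1 ((hξ k).and (eventually_gt_atTop 0))
  refine ⟨T, fun t ht => ?_⟩
  obtain ⟨h1, h2⟩ := hT t ht.le
  have htpos : (0 : ℝ) < t := by exact_mod_cast h2
  rw [Real.dist_eq, sub_zero, abs_div, abs_of_pos htpos, div_lt_iff₀ htpos]
  exact h1.trans (mul_lt_mul_of_pos_right hk htpos)

/-! ### The limit in an absorbing configuration -/

open Classical in
/-- The share of a site in the particles received by its block of `P`. -/
def weight (P : Finset (ZMod M)) (i : ZMod M) : ℝ :=
  if Iso P i then 1 else if i ∈ P then 1 / 2 else 0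

theorem weight_iso {P : Finset (ZMod M)} {i : ZMod M} (h : Iso P i) : weight P i = 1 := by
  simp [weight, h]

theorem weight_pair {P : Finset (ZMod M)} {i : ZMod M} (h : ¬ Iso P i) (hi : i ∈ P) :
    weight P i = 1 / 2 := by
  simp [weight, h, hi]

theorem weight_notMem {P : Finset (ZMod M)} {i : ZMod M} (hi : i ∉ P) : weight P i = 0 := by
  have h : ¬ Iso P i := fun h => hi h.1
  simp [weight, h, hi]

theorem weight_nonneg (P : Finset (ZMod M)) (i : ZMod M) : 0 ≤ weight P i := by
  unfold weight
  split_ifs <;> norm_num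

theorem weight_pos_iff {P : Finset (ZMod M)} {i : ZMod M} : 0 < weight P i ↔ i ∈ P := by
  by_cases hi : i ∈ P
  · by_cases h : Iso P i
    · simp [weight_iso h, hi]
    · simp [weight_pair h hi, hi]
  · simp [weight_notMem hi, hi]

/-- A site of `P` sees exactly its own block, of total weight 1. Hence every particle raises the
weighted sum of potentials by exactly 1, whatever block it hits. -/
theorem weight_sum_nbhd {P : Finset (ZMod M)} (hP : NoTriple P) {p : ZMod M} (hp : p ∈ P) :
    weight P (p - 1) + weight P p + weight P (p + 1) = 1 := by
  have e1 : p - 1 + 1 = p := by ring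
  have e2 : p - 1 + 2 = p + 1 := by ring
  have e3 : p + 1 - 1 = p := by ring
  have h3 := hP (p - 1)
  rw [e1, e2] at h3
  by_cases hl : p - 1 ∈ P
  · have hr := h3 hl hp
    rw [weight_pair (fun h => h.2.2 (by rwa [e1])) hl, weight_pair (fun h => h.2.1 hl) hp,
      weight_notMem hr]
    norm_num
  · by_cases hr : p + 1 ∈ P
    · rw [weight_notMem hl, weight_pair (fun h => h.2.2 hr) hp,
        weight_pair (fun h => h.2.1 (by rwa [e3])) hr]
      norm_num
    · rw [weight_notMem hl, weight_iso ⟨hp, hl, hr⟩, weight_notMem hr]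
      norm_num

/-- The number of blocks of `P`. -/
def blocks (P : Finset (ZMod M)) : ℝ := ∑ i, weight P i

theorem blocks_pos {P : Finset (ZMod M)} {p : ZMod M} (hp : p ∈ P) : 0 < blocks P :=
  Finset.sum_pos' (fun i _ => weight_nonneg P i) ⟨p, Finset.mem_univ _, weight_pos_iff.2 hp⟩

/-- The sum of the levels of the blocks. -/
def blockLevel (P : Finset (ZMod M)) (c : Config M) : ℝ := ∑ i, weight P i * potential c i

theorem blockLevel_step {P : Finset (ZMod M)} (hM : 4 ≤ M) (hP : NoTriple P) {p : ZMod M}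
    (hp : p ∈ P) (c : Config M) : blockLevel P (c + Pi.single p 1) = blockLevel P c + 1 := by
  have hs : ∑ i, weight P i * (potential (Pi.single p 1 : Config M) i : ℝ) = 1 := by
    have off := offsets_ne hM p
    rw [← weight_sum_nbhd hP hp]
    have h1 : ∀ i, weight P i * (potential (Pi.single p 1 : Config M) i : ℝ) =
        (if i = p - 1 then weight P i else 0) + (if i = p then weight P i else 0) +
          (if i = p + 1 then weight P i else 0) := by
      intro i
      rw [potential_eq hM]
      have a1 : (i - 1 = p) ↔ i = p + 1 :=
        ⟨fun h => by rw [← h]; ring, fun h => by rw [h]; ring⟩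
      have a2 : (i + 1 = p) ↔ i = p - 1 :=
        ⟨fun h => by rw [← h]; ring, fun h => by rw [h]; ring⟩
      simp only [Pi.single_apply, a1, a2]
      push_cast
      simp only [mul_add, mul_ite, mul_one, mul_zero]
      ring
    rw [Finset.sum_congr rfl fun i _ => h1 i, Finset.sum_add_distrib, Finset.sum_add_distrib]
    simp
  unfold blockLevel
  simp only [potential_add, Nat.cast_add, mul_add, Finset.sum_add_distrib]
  rw [hs]

theorem blockLevel_bounds {P : Finset (ZMod M)} {c : Config M} (hc : Tame P c) :
    blocks P * minPotential c ≤ blockLevel P c ∧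
      blockLevel P c ≤ blocks P * (minPotential c + 1) := by
  unfold blocks blockLevel
  rw [Finset.sum_mul, Finset.sum_mul]
  constructor
  · refine Finset.sum_le_sum fun i _ => mul_le_mul_of_nonneg_left ?_ (weight_nonneg P i)
    exact_mod_cast minPotential_le c i
  · refine Finset.sum_le_sum fun i _ => ?_
    by_cases hi : i ∈ P
    · refine mul_le_mul_of_nonneg_left ?_ (weight_nonneg P i)
      exact_mod_cast hc.le i hi
    · simp [weight_notMem hi]

/-- A trajectory that stays absorbed by the pattern `P`. -/
structure Absorbed (P : Finset (ZMod M)) (ξ : ℕ → Config M) : Prop where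
  tame : ∀ t, Tame P (ξ t)
  step : ∀ t, ∃ i ∈ minSites (ξ t), ξ (t + 1) = ξ t + Pi.single i 1
  even : ∀ a, a ∈ P → a + 1 ∈ P →
    Tendsto (fun t : ℕ => ((ξ t a : ℝ) - ξ t (a + 1)) / t) atTop (𝓝 0)

theorem Absorbed.const {P : Finset (ZMod M)} {ξ : ℕ → Config M} (h : Absorbed P ξ) {j : ZMod M}
    (hj : j ∉ P) (t : ℕ) : ξ t j = ξ 0 j := by
  induction t with
  | zero => rfl
  | succ t ih =>
    obtain ⟨i, hi, e⟩ := h.step t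
    have : j ≠ i := fun e => hj (e ▸ (h.tame t).mem hi)
    rw [e, Pi.add_apply, Pi.single_eq_of_ne this, ih, add_zero]

theorem Absorbed.blockLevel_eq {P : Finset (ZMod M)} {ξ : ℕ → Config M} (hM : 4 ≤ M)
    (h : Absorbed P ξ) (t : ℕ) : blockLevel P (ξ t) = blockLevel P (ξ 0) + t := by
  induction t with
  | zero => simp
  | succ t ih =>
    obtain ⟨i, hi, e⟩ := h.step t
    rw [e, blockLevel_step hM (h.tame t).noTriple ((h.tame t).mem hi), ih]
    push_cast
    ring

theorem tendsto_const_div_nat (r : ℝ) : Tendsto (fun t : ℕ => r / (t : ℝ)) atTop (𝓝 0) :=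
  tendsto_const_nhds.div_atTop tendsto_natCast_atTop_atTop

theorem tendsto_div_of_bounded {x y : ℕ → ℝ} {C l : ℝ} (h : ∀ t, |x t - y t| ≤ C)
    (hy : Tendsto (fun t : ℕ => y t / t) atTop (𝓝 l)) :
    Tendsto (fun t : ℕ => x t / t) atTop (𝓝 l) := by
  have h0 : Tendsto (fun t : ℕ => (x t - y t) / t) atTop (𝓝 0) := by
    refine squeeze_zero_norm (fun t => ?_) (tendsto_const_div_nat C)
    rw [Real.norm_eq_abs, abs_div, Nat.abs_cast]
    exact div_le_div_of_nonneg_right (h t) (Nat.cast_nonneg t)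
  have := h0.add hy
  rw [zero_add] at this
  refine this.congr fun t => ?_
  ring

/-- The total block level grows by 1 per step and all blocks are within one of each other, so each
potential stays within 1 of the average level. -/
theorem Absorbed.tendsto_potential {P : Finset (ZMod M)} {ξ : ℕ → Config M} (hM : 4 ≤ M)
    (h : Absorbed P ξ) {a : ZMod M} (ha : a ∈ P) :
    Tendsto (fun t : ℕ => (potential (ξ t) a : ℝ) / t) atTop (𝓝 (1 / blocks P)) := by
  have hn := blocks_pos ha
  refine tendsto_div_of_bounded (y := fun t => (blockLevel P (ξ 0) + t) / blocks P) (C := 1)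
    (fun t => ?_) ?_
  · rw [← h.blockLevel_eq hM t]
    obtain ⟨h1, h2⟩ := blockLevel_bounds (h.tame t)
    have h3 : (minPotential (ξ t) : ℝ) ≤ potential (ξ t) a := by
      exact_mod_cast minPotential_le _ a
    have h4 : (potential (ξ t) a : ℝ) ≤ minPotential (ξ t) + 1 := by
      exact_mod_cast (h.tame t).le a ha
    have h5 : (minPotential (ξ t) : ℝ) ≤ blockLevel P (ξ t) / blocks P := by
      rw [le_div_iff₀ hn]; linarith
    have h6 : blockLevel P (ξ t) / blocks P ≤ minPotential (ξ t) + 1 := by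
      rw [div_le_iff₀ hn]; linarith
    rw [abs_le]
    constructor <;> linarith
  · have h1 : Tendsto (fun t : ℕ => (blockLevel P (ξ 0) / blocks P) / t + 1 / blocks P) atTop
        (𝓝 (0 + 1 / blocks P)) := (tendsto_const_div_nat _).add_const _
    rw [zero_add] at h1
    refine h1.congr' ?_
    filter_upwards [eventually_gt_atTop 0] with t ht
    have : (t : ℝ) ≠ 0 := by exact_mod_cast ht.ne'
    field_simp

/-- The potential of `a` gives the sum of the two coordinates up to the frozen site `a - 1`; their
difference is negligible. -/
theorem Absorbed.tendsto_pair {P : Finset (ZMod M)} {ξ : ℕ → Config M} (hM : 4 ≤ M)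
    (h : Absorbed P ξ) {a : ZMod M} (ha : a ∈ P) (ha1 : a + 1 ∈ P) :
    Tendsto (fun t : ℕ => (ξ t a : ℝ) / t) atTop (𝓝 (1 / 2 / blocks P)) ∧
      Tendsto (fun t : ℕ => (ξ t (a + 1) : ℝ) / t) atTop (𝓝 (1 / 2 / blocks P)) := by
  have e1 : a - 1 + 1 = a := by ring
  have e2 : a - 1 + 2 = a + 1 := by ring
  have hl : a - 1 ∉ P := by
    intro hl
    have := (h.tame 0).noTriple (a - 1) hl
    rw [e1, e2] at this
    exact this ha ha1
  have hpot := h.tendsto_potential hM ha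
  have hev := h.even a ha ha1
  have hc := tendsto_const_div_nat (ξ 0 (a - 1) : ℝ)
  constructor
  · have := ((hpot.sub hc).add hev).div_const 2
    refine (this.congr fun t => ?_).trans_eq ?_
    · rw [potential_eq hM, h.const hl]
      push_cast
      ring
    · congr 1; ring
  · have := ((hpot.sub hc).sub hev).div_const 2
    refine (this.congr fun t => ?_).trans_eq ?_
    · rw [potential_eq hM, h.const hl]
      push_cast
      ring
    · congr 1; ring

theorem Absorbed.hasLimit {P : Finset (ZMod M)} {ξ : ℕ → Config M} (hM : 4 ≤ M)
    (h : Absorbed P ξ) : HasLimit ξ fun i => weight P i / blocks P := by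
  refine tendsto_pi_nhds.2 fun i => ?_
  by_cases hi : i ∈ P
  · by_cases hiso : Iso P i
    · rw [weight_iso hiso]
      have hc := tendsto_const_div_nat ((ξ 0 (i - 1) : ℝ) + ξ 0 (i + 1))
      have := (h.tendsto_potential hM hi).sub hc
      rw [sub_zero] at this
      refine this.congr fun t => ?_
      rw [potential_eq hM, h.const hiso.2.1, h.const hiso.2.2]
      push_cast
      ring
    · rw [weight_pair hiso hi]
      by_cases hl : i - 1 ∈ P
      · have := (h.tendsto_pair hM hl (by rwa [sub_add_cancel])).2
        rwa [sub_add_cancel] at this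
      · have hr : i + 1 ∈ P := by
          by_contra hr
          exact hiso ⟨hi, hl, hr⟩
        exact (h.tendsto_pair hM hi hr).1
  · rw [weight_notMem hi, zero_div]
    simp only [h.const hi]
    exact tendsto_const_div_nat _

theorem ae_absorbed (hM : 4 ≤ M) {P : Finset (ZMod M)} (hP : Guarded P) {c : Config M}
    (hc : Tame P c) : ∀ᵐ ξ ∂(law c), Absorbed P ξ := by
  have h1 : ∀ᵐ ξ ∂(law c), ∀ t, Tame P (ξ t) ∧
      ∃ i ∈ minSites (ξ t), ξ (t + 1) = ξ t + Pi.single i 1 :=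
    ae_all_iff.2 fun t => law_forall_of_closed
      (fun c hc i hi => hc.step_guarded hP hi) t c hc
  have h2 : ∀ᵐ ξ ∂(law c), ∀ a : ZMod M, a ∈ P → a + 1 ∈ P →
      Tendsto (fun t : ℕ => ((ξ t a : ℝ) - ξ t (a + 1)) / t) atTop (𝓝 0) := by
    refine ae_all_iff.2 fun a => ?_
    by_cases ha : a ∈ P ∧ a + 1 ∈ P
    · filter_upwards [ae_tendsto_difference hM hP ha.1 ha.2 hc] with ξ hξ _ _
      exact hξ
    · exact Eventually.of_forall fun ξ h h' => absurd ⟨h, h'⟩ ha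
  filter_upwards [h1, h2] with ξ a b
  exact ⟨fun t => (a t).1, fun t => (a t).2, b⟩

/-! ### Absorbing configurations obey the rules. -/

/-- Neighbourhoods centred at the sites of one class modulo 3 tile the cycle, so both sums count all
particles. The induction telescopes the difference. -/
theorem sum_potential_class (hM : 4 ≤ M) {K : ℕ} (hK : M = 3 * K) (c : Config M) (r : ZMod M) :
    ∑ k ∈ Finset.range K, potential c (r + 3 * k + 1) =
      ∑ k ∈ Finset.range K, potential c (r + 3 * k) := by
  have key : ∀ n : ℕ, ∑ k ∈ Finset.range n, potential c (r + 3 * k + 1) + c (r - 1) =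
      ∑ k ∈ Finset.range n, potential c (r + 3 * k) + c (r - 1 + 3 * n) := by
    intro n
    induction n with
    | zero => simp
    | succ n ih =>
      have e1 : r + 3 * (n : ZMod M) + 1 - 1 = r + 3 * n := by ring
      have e2 : r + 3 * (n : ZMod M) + 1 + 1 = r - 1 + 3 * (n + 1) := by ring
      have e3 : r + 3 * (n : ZMod M) - 1 = r - 1 + 3 * n := by ring
      have h1 : potential c (r + 3 * n + 1) =
          c (r + 3 * n) + c (r + 3 * n + 1) + c (r - 1 + 3 * (n + 1)) := by
        rw [potential_eq hM, e1, e2]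
      have h2 : potential c (r + 3 * n) =
          c (r - 1 + 3 * n) + c (r + 3 * n) + c (r + 3 * n + 1) := by
        rw [potential_eq hM, e3]
      rw [Finset.sum_range_succ, Finset.sum_range_succ, Nat.cast_add, Nat.cast_one, h1, h2]
      omega
  have h := key K
  have h0 : (3 : ZMod M) * K = 0 := by
    have := ZMod.natCast_self M
    rw [hK] at this ⊢
    push_cast at this
    exact this
  rw [h0, add_zero] at h
  omega

/-- If a whole class lay in `P`, guardedness would make all its sites isolated, hence each strictly
below its successor, against the equality of the class sums. -/
theorem Tame.exists_class_notMem (hM : 4 ≤ M) {P : Finset (ZMod M)} (hP : Guarded P) {c : Config M}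
    (hc : Tame P c) {K : ℕ} (hK : M = 3 * K) (r : ZMod M) : ∃ k < K, r + 3 * (k : ZMod M) ∉ P := by
  by_contra! hcon
  have h0 : (3 : ZMod M) * K = 0 := by
    have := ZMod.natCast_self M
    rw [hK] at this ⊢
    push_cast at this
    exact this
  have hKpos : 0 < K := by omega
  have hmod : ∀ k : ℕ, r + 3 * (k : ZMod M) ∈ P := by
    intro k
    have h1 := hcon (k % K) (Nat.mod_lt _ hKpos)
    have h2 : (k : ZMod M) = (k % K : ℕ) + K * (k / K : ℕ) := by
      rw [← Nat.cast_mul, ← Nat.cast_add, Nat.mod_add_div]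
    have h3 : r + 3 * (k : ZMod M) = r + 3 * ((k % K : ℕ) : ZMod M) := by
      rw [h2]
      linear_combination ((k / K : ℕ) : ZMod M) * h0
    rwa [h3]
  -- If `i` were half of a pair, the gap on its other side would need an isolated guard two sites
  -- away from `i`; but that site is adjacent to `i + 3` or `i - 3`, which is in `P`.
  have hiso : ∀ k : ℕ, Iso P (r + 3 * (k : ZMod M)) := by
    intro k
    have hi := hmod k
    have hnext : r + 3 * (k : ZMod M) + 3 ∈ P := by
      have := hmod (k + 1)
      push_cast at this
      convert this using 1
      ring
    have hprev : r + 3 * (k : ZMod M) - 3 ∈ P := by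
      have := hmod (k + (K - 1))
      have e : ((K - 1 : ℕ) : ZMod M) = K - 1 := by
        rw [Nat.cast_sub (by omega), Nat.cast_one]
      push_cast at this
      rw [e] at this
      convert this using 1
      linear_combination -h0
    generalize r + 3 * (k : ZMod M) = i at hi hnext hprev
    have hT := hc.noTriple (i - 1)
    have e1 : i - 1 + 1 = i := by ring
    have e2 : i - 1 + 2 = i + 1 := by ring
    rw [e1, e2] at hT
    by_contra hn
    by_cases hl : i - 1 ∈ P
    · have hr := hT hl hi
      rcases hP (i + 1) hr with h | h
      · rw [add_sub_cancel_right] at h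
        exact hn h
      · refine h.2.2 ?_
        convert hnext using 1
        ring
    · rcases hP (i - 1) hl with h | h
      · refine h.2.1 ?_
        convert hprev using 1
        ring
      · rw [e1] at h
        exact hn h
  have hlt : ∑ k ∈ Finset.range K, potential c (r + 3 * k) <
      ∑ k ∈ Finset.range K, potential c (r + 3 * k + 1) :=
    Finset.sum_lt_sum_of_nonempty ⟨0, by simpa using hKpos⟩ fun k _ => (hc.iso _ (hiso k)).2
  exact hlt.ne' (sum_potential_class hM hK c r)

theorem Tame.rules (hM : 4 ≤ M) {P : Finset (ZMod M)} (hP : Guarded P) {c : Config M}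
    (hc : Tame P c) : Rules (fun i => weight P i / blocks P) (1 / blocks P) := by
  obtain ⟨q, hq⟩ := minSites_nonempty c
  have hn : 0 < blocks P := blocks_pos (hc.mem hq)
  have hzero : ∀ {i}, weight P i / blocks P = 0 ↔ i ∉ P := by
    intro i
    rw [div_eq_zero_iff, or_iff_left hn.ne', ← weight_pos_iff, not_lt]
    exact ⟨fun h => h.le, fun h => le_antisymm h (weight_nonneg P i)⟩
  have hpos : ∀ {i}, 0 < weight P i / blocks P ↔ i ∈ P := by
    intro i
    rw [div_pos_iff_of_pos_right hn, weight_pos_iff]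
  have hone : ∀ {i}, Iso P i → weight P i / blocks P = 1 / blocks P := fun h => by
    rw [weight_iso h]
  have hhalf : ∀ {i}, i ∈ P → ¬ Iso P i → weight P i / blocks P = 1 / blocks P / 2 := by
    intro i hi h
    rw [weight_pair h hi]
    ring
  have hα : 0 < 1 / blocks P := by positivity
  refine ⟨hα, fun i => ?_, ?_, fun i hi => ?_, fun i hi => ?_, fun i hi => ?_,
    fun K hK j _ => ⟨?_, ?_⟩⟩
  · by_cases hi : i ∈ P
    · by_cases h : Iso P i
      · exact Or.inr (Or.inr (hone h))
      · exact Or.inr (Or.inl (hhalf hi h))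
    · exact Or.inl (hzero.2 hi)
  · rw [← Finset.sum_div]
    exact div_self hn.ne'
  · rcases hP i (hzero.1 hi) with h | h
    · exact Or.inl (hpos.2 h.1)
    · exact Or.inr (hpos.2 h.1)
  · have hiP : i ∈ P := hpos.1 (by rw [hi]; positivity)
    have hnot : ¬ Iso P i := fun h => by
      rw [hone h] at hi
      linarith
    have pair : ∀ a, a ∈ P → a + 1 ∈ P → Iso P (a - 2) ∧ a - 1 ∉ P ∧ ¬ Iso P a ∧ ¬ Iso P (a + 1) ∧
        a + 2 ∉ P ∧ Iso P (a + 3) := by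
      intro a ha ha1
      have e1 : a - 1 + 1 = a := by ring
      have e2 : a - 1 + 2 = a + 1 := by ring
      have e3 : a + 2 - 1 = a + 1 := by ring
      have e4 : a + 2 + 1 = a + 3 := by ring
      have e5 : a - 1 - 1 = a - 2 := by ring
      have hT := hc.noTriple (a - 1)
      rw [e1, e2] at hT
      have hl : a - 1 ∉ P := fun h => hT h ha ha1
      have hr := hc.noTriple a ha ha1
      have n1 : ¬ Iso P a := fun h => h.2.2 ha1
      have n2 : ¬ Iso P (a + 1) := fun h => h.2.1 (by rwa [add_sub_cancel_right])
      refine ⟨?_, hl, n1, n2, hr, ?_⟩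
      · have := hP _ hl
        rw [e1, e5] at this
        exact this.resolve_right n1
      · have := hP _ hr
        rw [e3, e4] at this
        exact this.resolve_left n2
    by_cases hl : i - 1 ∈ P
    · refine ⟨i, Or.inl rfl, ?_⟩
      obtain ⟨h1, h2, h3, h4, h5, h6⟩ := pair (i - 1) hl (by rwa [sub_add_cancel])
      have e1 : i - 1 - 2 = i - 3 := by ring
      have e2 : i - 1 - 1 = i - 2 := by ring
      have e3 : i - 1 + 2 = i + 1 := by ring
      have e4 : i - 1 + 3 = i + 2 := by ring
      rw [e1] at h1
      rw [e2] at h2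
      rw [e3] at h5
      rw [e4] at h6
      exact ⟨hone h1, hzero.2 h2, hhalf hl h3, hi, hzero.2 h5, hone h6⟩
    · have hr : i + 1 ∈ P := by
        by_contra hr
        exact hnot ⟨hiP, hl, hr⟩
      refine ⟨i + 1, Or.inr rfl, ?_⟩
      obtain ⟨h1, h2, h3, h4, h5, h6⟩ := pair i hiP hr
      have e1 : i + 1 - 3 = i - 2 := by ring
      have e2 : i + 1 - 2 = i - 1 := by ring
      have e3 : i + 1 - 1 = i := by ring
      have e4 : i + 1 + 1 = i + 2 := by ring
      have e5 : i + 1 + 2 = i + 3 := by ring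
      rw [e1, e2, e3, e4, e5]
      exact ⟨hone h1, hzero.2 h2, hi, hhalf hr h4, hzero.2 h5, hone h6⟩
  · have hiP : i ∈ P := hpos.1 (by rw [hi]; exact hα)
    have hiso : Iso P i := by
      by_contra h
      rw [hhalf hiP h] at hi
      linarith
    exact ⟨hzero.2 hiso.2.1, hzero.2 hiso.2.2⟩
  · obtain ⟨k, hk, h⟩ := hc.exists_class_notMem hM hP hK (j : ZMod M)
    refine ⟨k, hk, (hzero.2 ?_).symm⟩
    push_cast
    exact h
  · rintro y ⟨k, -, rfl⟩
    exact div_nonneg (weight_nonneg P _) hn.le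

/-! ### Every configuration that satisfies the rules is a limit -/

theorem sum_range_shift (F : ℕ → ℤ) (n : ℕ) :
    ∑ k ∈ Finset.range n, F (k + 1) = ∑ k ∈ Finset.range n, F k + F n - F 0 := by
  have h1 := Finset.sum_range_succ F n
  have h2 := Finset.sum_range_succ' F n
  linarith

theorem three_mul_card (i : ZMod M) : i + 3 * (M : ZMod M) = i := by simp

/-- The sum over the orbit of `i` under translation by three. -/
def orbitSum (f : ZMod M → ℤ) (i : ZMod M) : ℤ := ∑ k ∈ Finset.range M, f (i + 3 * k)

theorem orbitSum_add_three (f : ZMod M → ℤ) (i : ZMod M) :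
    orbitSum f (i + 3) = orbitSum f i := by
  have h := sum_range_shift (fun k => f (i + 3 * k)) M
  simp only [three_mul_card, Nat.cast_zero, mul_zero, add_zero, add_sub_cancel_right] at h
  unfold orbitSum
  rw [← h]
  refine Finset.sum_congr rfl fun k _ => congrArg f ?_
  push_cast
  ring

theorem orbitSum_add_three_mul (f : ZMod M → ℤ) (i : ZMod M) (k : ℕ) :
    orbitSum f (i + 3 * k) = orbitSum f i := by
  induction k with
  | zero => simp
  | succ k ih =>
    rw [← ih, ← orbitSum_add_three f (i + 3 * k)]
    congr 1
    push_cast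
    ring

/-- The equation `F (i + 3) - F i = M * d i` is solvable when `d` has vanishing orbit sums. -/
theorem exists_primitive (d : ZMod M → ℤ) (hd : ∀ i, orbitSum d i = 0) :
    ∃ F : ZMod M → ℤ, ∀ i, F (i + 3) = F i + M * d i := by
  -- Summation by parts: the linear weight `k` leaves the boundary term `M * d i` minus an orbit
  -- sum, which vanishes. The factor `M` avoids any division and any distinction on whether 3
  -- divides `M`.
  refine ⟨fun i => ∑ k ∈ Finset.range M, (k : ℤ) * d (i + 3 * k), fun i => ?_⟩
  have h := sum_range_shift (fun k => (k : ℤ) * d (i + 3 * k)) M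
  have h1 := sum_range_shift (fun k => d (i + 3 * k)) M
  have h2 := hd i
  unfold orbitSum at h2
  simp only [three_mul_card, Nat.cast_zero, mul_zero, zero_mul, add_zero, sub_zero] at h h1
  beta_reduce
  rw [← h]
  have h3 : ∑ k ∈ Finset.range M, (k : ℤ) * d (i + 3 + 3 * k) =
      ∑ k ∈ Finset.range M, ((k + 1 : ℕ) : ℤ) * d (i + 3 * ((k + 1 : ℕ) : ZMod M)) -
      ∑ k ∈ Finset.range M, d (i + 3 * ((k + 1 : ℕ) : ZMod M)) := by
    rw [← Finset.sum_sub_distrib]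
    refine Finset.sum_congr rfl fun k _ => ?_
    have : i + 3 + 3 * (k : ZMod M) = i + 3 * ((k + 1 : ℕ) : ZMod M) := by push_cast; ring
    rw [this]
    push_cast
    ring
  rw [h3, h1, h2]
  ring

theorem eq_const_of_add_one {G : ZMod M → ℤ} (h : ∀ i, G (i + 1) = G i) (i : ZMod M) :
    G i = G 0 := by
  have : ∀ n : ℕ, G (n : ZMod M) = G 0 := by
    intro n
    induction n with
    | zero => simp
    | succ n ih => rw [Nat.cast_succ, h, ih]
  rw [← ZMod.natCast_zmod_val i]
  exact this _

/-- Potentials may be prescribed up to a factor and an additive constant, as long as their orbit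
sums agree. -/
theorem exists_config_potential (hM : 4 ≤ M) (v : ZMod M → ℤ)
    (hv : ∀ i, orbitSum v (i + 1) = orbitSum v i) :
    ∃ (η : Config M) (C : ℤ), ∀ i, (potential η i : ℤ) = C + M * v i := by
  -- The difference of the potentials of `F` at `i + 2` and `i + 1` is `F (i + 3) - F i`, so
  -- matching increments of `M * v` is a primitive problem with step 3.
  obtain ⟨F, hF⟩ := exists_primitive (fun i => v (i + 2) - v (i + 1)) (by
    intro i
    have h1 : orbitSum (fun i => v (i + 2) - v (i + 1)) i =
        orbitSum v (i + 1 + 1) - orbitSum v (i + 1) := by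
      unfold orbitSum
      rw [← Finset.sum_sub_distrib]
      refine Finset.sum_congr rfl fun k _ => ?_
      have e1 : i + 1 + 1 + 3 * (k : ZMod M) = i + 3 * k + 2 := by ring
      have e2 : i + 1 + 3 * (k : ZMod M) = i + 3 * k + 1 := by ring
      rw [e1, e2]
    rw [h1, hv, sub_self])
  -- A constant shift that makes all particle numbers nonnegative and changes every potential by the
  -- same `3 * B`.
  set B : ℤ := ∑ i, |F i| with hB
  have hBF : ∀ i, 0 ≤ F i + B := by
    intro i
    have h1 : |F i| ≤ B := Finset.single_le_sum (f := fun i => |F i|) (fun _ _ => abs_nonneg _)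
      (Finset.mem_univ i)
    have h2 := neg_abs_le (F i)
    linarith
  have hG := eq_const_of_add_one (G := fun i => F (i - 1) + F i + F (i + 1) - M * v i) (by
    intro i
    have h := hF (i - 1)
    have e1 : i - 1 + 3 = i + 1 + 1 := by ring
    have e2 : i - 1 + 2 = i + 1 := by ring
    have e3 : i - 1 + 1 = i := by ring
    rw [e1, e2, e3] at h
    simp only [add_sub_cancel_right]
    rw [h]
    ring)
  refine ⟨fun i => (F i + B).toNat, (F (0 - 1) + F 0 + F (0 + 1) - M * v 0) + 3 * B, fun i => ?_⟩
  have := hG i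
  rw [potential_eq hM, ← this]
  push_cast
  rw [Int.toNat_of_nonneg (hBF _), Int.toNat_of_nonneg (hBF _), Int.toNat_of_nonneg (hBF _)]
  ring

/-- Potentials are prescribed to be constant on `P` and larger elsewhere; the only obstruction is
equality of orbit sums, which can be arranged since every orbit meets the complement of `P`. -/
theorem exists_tame (hM : 4 ≤ M) {P : Finset (ZMod M)} (hP : NoTriple P) (hne : P.Nonempty)
    (hgap : ∀ i : ZMod M, ∃ k < M, i + 3 * (k : ZMod M) ∉ P) : ∃ η, Tame P η := by
  set W : ZMod M → ℤ := orbitSum fun i => if i ∈ P then 0 else 1 with hW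
  have hWpos : ∀ i, 0 < W i := by
    intro i
    obtain ⟨k, hk, h⟩ := hgap i
    refine Finset.sum_pos' (fun k _ => by beta_reduce; split_ifs <;> norm_num)
      ⟨k, Finset.mem_range.2 hk, ?_⟩
    simp [h]
  have hW3 : ∀ (i : ZMod M) (k : ℕ), W (i + 3 * k) = W i := orbitSum_add_three_mul _
  -- `W i` counts the gaps along the orbit of `i`. Weighting the gaps by the counts of the other two
  -- orbits makes each orbit sum the symmetric product `W i * (W (i + 1) * W (i + 2))`.
  set v : ZMod M → ℤ := fun i => (if i ∈ P then 0 else 1) * (W (i + 1) * W (i + 2)) with hv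
  have hsum : ∀ i, orbitSum v i = W i * (W (i + 1) * W (i + 2)) := by
    intro i
    have : ∀ k ∈ Finset.range M, v (i + 3 * k) =
        (if i + 3 * (k : ZMod M) ∈ P then 0 else 1) * (W (i + 1) * W (i + 2)) := by
      intro k _
      have e1 : i + 3 * (k : ZMod M) + 1 = i + 1 + 3 * k := by ring
      have e2 : i + 3 * (k : ZMod M) + 2 = i + 2 + 3 * k := by ring
      simp only [hv]
      rw [e1, e2, hW3, hW3]
    unfold orbitSum
    rw [Finset.sum_congr rfl this, ← Finset.sum_mul]
    rfl
  obtain ⟨η, C, hη⟩ := exists_config_potential hM v (by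
    intro i
    have e1 : i + 1 + 1 = i + 2 := by ring
    have e2 : i + 1 + 2 = i + 3 * ((1 : ℕ) : ZMod M) := by push_cast; ring
    rw [hsum, hsum, e1, e2, hW3]
    ring)
  have hMpos : (0 : ℤ) < M := by exact_mod_cast (by omega : 0 < M)
  have hin : ∀ i ∈ P, (potential η i : ℤ) = C := by
    intro i hi
    rw [hη, hv]
    simp [hi]
  have hout : ∀ i ∉ P, C < (potential η i : ℤ) := by
    intro i hi
    have : 0 < (M : ℤ) * v i := by
      simp only [hv, hi, if_false, one_mul]
      exact mul_pos hMpos (mul_pos (hWpos _) (hWpos _))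
    rw [hη]
    linarith
  have hall : ∀ i, C ≤ (potential η i : ℤ) := by
    intro i
    by_cases hi : i ∈ P
    · exact (hin i hi).ge
    · exact (hout i hi).le
  have hmin : (minPotential η : ℤ) = C := by
    obtain ⟨p, hp⟩ := hne
    obtain ⟨q, hq⟩ := minSites_nonempty η
    refine le_antisymm ?_ ?_
    · rw [← hin p hp]
      exact_mod_cast minPotential_le η p
    · rw [← mem_minSites.1 hq]
      exact hall q
  have hmem : minSites η = P := by
    ext i
    rw [mem_minSites]
    constructor
    · intro h
      by_contra hi
      have := hout i hi
      rw [h, hmin] at this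
      exact lt_irrefl _ this
    · intro hi
      have := hin i hi
      rw [← hmin] at this
      exact_mod_cast this
  exact ⟨η, by have := tame_minSites (c := η) (by rwa [hmem]); rwa [hmem] at this⟩

theorem natCast_surj_orbit (h : ¬ 3 ∣ M) (i j : ZMod M) : ∃ k < M, i + 3 * ((k : ℕ) : ZMod M) = j := by
  have hcop : Nat.Coprime 3 M := (Nat.Prime.coprime_iff_not_dvd Nat.prime_three).2 h
  have hu := ZMod.coe_mul_inv_eq_one 3 hcop
  refine ⟨(((3 : ℕ) : ZMod M)⁻¹ * (j - i)).val, ZMod.val_lt _, ?_⟩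
  rw [ZMod.natCast_zmod_val]
  push_cast at hu ⊢
  linear_combination (j - i) * hu

theorem exists_tame_of_rules (hM : 4 ≤ M) {x : ZMod M → ℝ} {α : ℝ} (h : Rules x α) :
    ∃ (P : Finset (ZMod M)) (η : Config M), Guarded P ∧ Tame P η ∧
      x = fun i => weight P i / blocks P := by
  have hα := h.pos
  set P : Finset (ZMod M) := Finset.univ.filter fun i => 0 < x i with hPdef
  have hP : ∀ i, i ∈ P ↔ 0 < x i := fun i => by simp [hPdef]
  have hP0 : ∀ i, i ∉ P ↔ x i = 0 := by
    intro i
    rw [hP]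
    rcases h.mem i with e | e | e <;> rw [e]
    · simp
    · exact ⟨fun h => absurd (by positivity) h, fun h => by linarith⟩
    · exact ⟨fun h => absurd hα h, fun h => by linarith⟩
  have hfull : ∀ i, x i = α → Iso P i := by
    intro i hi
    have := h.full i hi
    exact ⟨(hP i).2 (by rw [hi]; exact hα), (hP0 _).2 this.1, (hP0 _).2 this.2⟩
  have hpair : ∀ i, x i = α / 2 → ¬ Iso P i ∧
      ((i - 1 ∉ P ∧ Iso P (i - 2) ∧ i + 1 ∈ P) ∨ (i + 1 ∉ P ∧ Iso P (i + 2) ∧ i - 1 ∈ P)) := by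
    intro i hi
    obtain ⟨j, hj, h1, h2, h3, h4, h5, h6⟩ := h.half i hi
    have hpos : 0 < α / 2 := by positivity
    rcases hj with rfl | rfl
    · have hm : j - 1 ∈ P := (hP _).2 (by rw [h3]; exact hpos)
      exact ⟨fun hh => hh.2.1 hm, Or.inr ⟨(hP0 _).2 h5, hfull _ h6, hm⟩⟩
    · have e1 : i + 1 - 3 = i - 2 := by ring
      have e2 : i + 1 - 2 = i - 1 := by ring
      rw [e1] at h1
      rw [e2] at h2
      have hm : i + 1 ∈ P := (hP _).2 (by rw [h4]; exact hpos)
      exact ⟨fun hh => hh.2.2 hm, Or.inl ⟨(hP0 _).2 h2, hfull _ h1, hm⟩⟩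
  have hcases : ∀ i ∈ P, x i = α / 2 ∨ x i = α := by
    intro i hi
    exact (h.mem i).resolve_left fun e => (hP0 i).2 e hi
  have hT : NoTriple P := by
    intro a ha ha1 ha2
    have e1 : a + 1 - 1 = a := by ring
    have e2 : a + 1 + 1 = a + 2 := by ring
    rcases hcases _ ha1 with e | e
    · have := (hpair _ e).2
      rw [e1, e2] at this
      rcases this with t | t
      exacts [t.1 ha, t.1 ha2]
    · have := (hfull _ e).2.1
      rw [e1] at this
      exact this ha
  have hG : Guarded P := by
    intro j hj
    have e1 : j - 1 + 1 = j := by ring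
    have e2 : j + 1 - 1 = j := by ring
    have e3 : j - 1 + 2 = j + 1 := by ring
    have e4 : j + 1 - 2 = j - 1 := by ring
    rcases h.zero j ((hP0 j).1 hj) with hx | hx
    · rcases hcases _ ((hP _).2 hx) with e | e
      · rcases (hpair _ e).2 with t | t
        · exact absurd (e1 ▸ t.2.2) hj
        · exact Or.inr (e3 ▸ t.2.1)
      · exact Or.inl (hfull _ e)
    · rcases hcases _ ((hP _).2 hx) with e | e
      · rcases (hpair _ e).2 with t | t
        · exact Or.inl (e4 ▸ t.2.1)
        · exact absurd (e2 ▸ t.2.2) hj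
      · exact Or.inr (hfull _ e)
  have hne : P.Nonempty := by
    by_contra hne
    rw [Finset.not_nonempty_iff_eq_empty] at hne
    have : ∀ i, x i = 0 := fun i => (hP0 i).1 (by simp [hne])
    have hs := h.sum_eq
    simp [this] at hs
  have hgap0 : ∃ j, j ∉ P := by
    obtain ⟨p, hp⟩ := hne
    by_contra! hall
    exact hT p hp (hall _) (hall _)
  have hgap : ∀ i : ZMod M, ∃ k < M, i + 3 * (k : ZMod M) ∉ P := by
    intro i
    by_cases h3 : 3 ∣ M
    · obtain ⟨K, hK⟩ := h3
      have hKpos : 0 < K := by omega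
      obtain ⟨j, hj, q, hq⟩ : ∃ j : ℕ, (j = 1 ∨ j = 2 ∨ j = 3) ∧ ∃ q : ℕ,
          (j : ZMod M) = i + 3 * (q : ZMod M) := by
        -- Representing `i` by `j` in {1, 2, 3} may need a move backwards; adding `i.val` full turns
        -- of the cycle keeps `q` a natural number without truncation.
        have hs : i.val ≤ i.val * K := Nat.le_mul_of_pos_right _ hKpos
        obtain ⟨j, hj, q, hq⟩ : ∃ j : ℕ, (j = 1 ∨ j = 2 ∨ j = 3) ∧ ∃ q : ℕ,
            j + 3 * (i.val * K) = i.val + 3 * q := by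
          have h2 : i.val % 3 < 3 := Nat.mod_lt _ (by norm_num)
          by_cases hb : i.val % 3 = 0
          · exact ⟨3, by omega, i.val * K + 1 - i.val / 3, by omega⟩
          · exact ⟨i.val % 3, by omega, i.val * K - i.val / 3, by omega⟩
        refine ⟨j, hj, q, ?_⟩
        have h3 : j + i.val * M = i.val + 3 * q := by
          have e : i.val * M = i.val * (3 * K) := congrArg (fun z => i.val * z) hK
          rw [← hq, e]
          ring
        have h4 := congrArg (Nat.cast (R := ZMod M)) h3
        push_cast at h4
        rw [ZMod.natCast_self, mul_zero, add_zero, ZMod.natCast_zmod_val] at h4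
        exact h4
      obtain ⟨⟨k, hk, hx⟩, -⟩ := h.mod_three K hK j hj
      refine ⟨(q + k) % M, Nat.mod_lt _ (by omega), (hP0 _).2 ?_⟩
      rw [hx]
      congr 1
      rw [ZMod.natCast_mod]
      push_cast
      rw [hq]
      ring
    · obtain ⟨j, hj⟩ := hgap0
      obtain ⟨k, hk, e⟩ := natCast_surj_orbit h3 i j
      exact ⟨k, hk, by rwa [e]⟩
  obtain ⟨η, hη⟩ := exists_tame hM hT hne hgap
  refine ⟨P, η, hG, hη, ?_⟩
  have hw : ∀ i, x i = weight P i * α := by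
    intro i
    by_cases hi : i ∈ P
    · rcases hcases i hi with e | e
      · rw [weight_pair (hpair i e).1 hi, e]; ring
      · rw [weight_iso (hfull i e), e]; ring
    · rw [weight_notMem hi, (hP0 i).1 hi, zero_mul]
  have hb : blocks P * α = 1 := by
    rw [← h.sum_eq, blocks, Finset.sum_mul]
    exact Finset.sum_congr rfl fun i _ => (hw i).symm
  funext i
  have hbp := blocks_pos hne.choose_spec
  rw [hw, eq_div_iff hbp.ne', mul_assoc, mul_comm α, hb, mul_one]

/-! ### The process started from the empty configuration -/

/-- The constraints, relative to the level `n`, on the potentials in the process started from the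
empty configuration. -/
structure SpreadAt (n : ℕ) (c : Config M) : Prop where
  pair : ∀ i, potential c i ≤ n + 1 ∨ potential c (i + 1) ≤ n + 1
  left : ∀ i, potential c i = n → potential c (i + 1) = n + 1 → potential c (i + 2) ≤ n + 1
  right : ∀ i, potential c (i + 2) = n → potential c (i + 1) = n + 1 → potential c i ≤ n + 1
  gap : ∀ i, potential c i = n → potential c (i + 1) = n + 1 → potential c (i + 2) = n + 1 →
    potential c (i + 3) ≠ n

/-- Each forbidden pattern can arise only from another forbidden one. Two neighbours above `n + 1`
would need a particle at the low end of n, n+1, ≥ n+2 (or its mirror image); that pattern would need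
a particle at one end of n, n+1, n+1, n; and a new such pattern cannot appear, as its two low ends
must have been missed, hence also its middle. -/
theorem SpreadAt.step_same (hM : 4 ≤ M) {c : Config M} (h : SpreadAt (minPotential c) c)
    {p : ZMod M} (hp : p ∈ minSites c) : SpreadAt (minPotential c) (c + Pi.single p 1) := by
  set n := minPotential c
  set c' := c + Pi.single p 1
  have hpn : potential c p = n := mem_minSites.1 hp
  have hge : ∀ i, n ≤ potential c i := minPotential_le c
  have hhit : ∀ i, p = i - 1 ∨ p = i ∨ p = i + 1 → potential c' i = potential c i + 1 :=
    fun i hi => by rw [potential_step, if_pos hi]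
  have hmiss : ∀ i, p ≠ i - 1 → p ≠ i → p ≠ i + 1 → potential c' i = potential c i :=
    fun i h1 h2 h3 => by
      rw [potential_step, if_neg (by rintro (h | h | h); exacts [h1 h, h2 h, h3 h]), add_zero]
  have hpn' : potential c' p = n + 1 := by rw [hhit p (Or.inr (Or.inl rfl)), hpn]
  have hlow : ∀ i, potential c' i = n →
      potential c i = n ∧ p ≠ i - 1 ∧ p ≠ i ∧ p ≠ i + 1 := by
    intro i hi
    by_cases hh : p = i - 1 ∨ p = i ∨ p = i + 1
    · have := hhit i hh
      have := hge i
      omega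
    · simp only [not_or] at hh
      exact ⟨(hmiss i hh.1 hh.2.1 hh.2.2) ▸ hi, hh⟩
  refine ⟨fun i => ?_, fun i h0 h1 => ?_, fun i h2 h1 => ?_, fun i h0 h1 h2 h3 => ?_⟩
  · by_cases e0 : p = i
    · exact Or.inl (by rw [← e0, hpn'])
    by_cases e1 : p = i + 1
    · exact Or.inr (by rw [← e1, hpn'])
    have f1 : i + 1 - 1 = i := by ring
    have f2 : i + 1 + 1 = i + 2 := by ring
    have f3 : i - 1 + 1 = i := by ring
    have f4 : i - 1 + 2 = i + 1 := by ring
    have hp0 := h.pair i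
    by_cases e2 : p = i - 1
    · have hm := hmiss (i + 1) (by rwa [f1]) e1
        (by rw [f2, e2]; exact (offsets_ne hM i).2.2.2.2.2.2.2.1.symm)
      have hh := hhit i (Or.inl e2)
      have hl := h.left (i - 1) (by rw [← e2, hpn])
      rw [f3, f4] at hl
      have := hge i
      omega
    · have hm := hmiss i e2 e0 e1
      by_cases e3 : p = i + 2
      · have hh := hhit (i + 1) (Or.inr (Or.inr (by rwa [f2])))
        have hr := h.right i (by rw [← e3, hpn])
        have := hge (i + 1)
        omega
      · have hm1 := hmiss (i + 1) (by rwa [f1]) e1 (by rwa [f2])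
        omega
  · obtain ⟨h0', a1, a2, a3⟩ := hlow i h0
    have f1 : i + 1 - 1 = i := by ring
    have f2 : i + 1 + 1 = i + 2 := by ring
    have f3 : i + 2 - 1 = i + 1 := by ring
    have f4 : i + 2 + 1 = i + 3 := by ring
    by_cases e2 : p = i + 2
    · rw [← e2, hpn']
    · have hm1 := hmiss (i + 1) (by rwa [f1]) a3 (by rwa [f2])
      have hl := h.left i h0' (by omega)
      by_cases e3 : p = i + 3
      · have hg := h.gap i h0' (by omega)
        have hh := hhit (i + 2) (Or.inr (Or.inr (by rwa [f4])))
        rw [← e3] at hg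
        have := hge (i + 2)
        omega
      · have hm2 := hmiss (i + 2) (by rwa [f3]) e2 (by rwa [f4])
        omega
  · obtain ⟨h2', a1, a2, a3⟩ := hlow (i + 2) h2
    have f1 : i + 1 - 1 = i := by ring
    have f2 : i + 1 + 1 = i + 2 := by ring
    have f3 : i + 2 - 1 = i + 1 := by ring
    have f4 : i - 1 + 1 = i := by ring
    have f5 : i - 1 + 2 = i + 1 := by ring
    have f6 : i - 1 + 3 = i + 2 := by ring
    rw [f3] at a1
    by_cases e0 : p = i
    · rw [← e0, hpn']
    · have hm1 := hmiss (i + 1) (by rwa [f1]) a1 (by rwa [f2])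
      have hr := h.right i h2' (by omega)
      by_cases e3 : p = i - 1
      · have hg := h.gap (i - 1) (by rw [← e3, hpn])
        rw [f4, f5, f6] at hg
        have hh := hhit i (Or.inl e3)
        have := hge i
        omega
      · have hm2 := hmiss i e3 e0 a1
        omega
  · obtain ⟨h0', a1, a2, a3⟩ := hlow i h0
    obtain ⟨h3', b1, b2, b3⟩ := hlow (i + 3) h3
    have f1 : i + 1 - 1 = i := by ring
    have f2 : i + 1 + 1 = i + 2 := by ring
    have f3 : i + 2 - 1 = i + 1 := by ring
    have f4 : i + 2 + 1 = i + 3 := by ring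
    have f5 : i + 3 - 1 = i + 2 := by ring
    rw [f5] at b1
    have hm1 := hmiss (i + 1) (by rwa [f1]) a3 (by rwa [f2])
    have hm2 := hmiss (i + 2) (by rwa [f3]) b1 (by rwa [f4])
    exact h.gap i h0' (by omega) (by omega) h3'

/-- No two neighbours exceed `n + 1`, and this alone implies all four constraints one level higher.
-/
theorem SpreadAt.succ {n : ℕ} {c : Config M} (h : SpreadAt n c) : SpreadAt (n + 1) c := by
  have f : ∀ i : ZMod M, i + 1 + 1 = i + 2 := fun i => by ring
  refine ⟨fun i => ?_, fun i _ h1 => ?_, fun i _ h1 => ?_, fun i _ h1 h2 _ => ?_⟩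
  · have := h.pair i
    omega
  · have := h.pair (i + 1)
    rw [f] at this
    omega
  · have := h.pair i
    omega
  · have := h.pair (i + 1)
    rw [f] at this
    omega

theorem SpreadAt.step (hM : 4 ≤ M) {c : Config M} (h : SpreadAt (minPotential c) c)
    {p : ZMod M} (hp : p ∈ minSites c) :
    SpreadAt (minPotential (c + Pi.single p 1)) (c + Pi.single p 1) := by
  have h1 := h.step_same hM hp
  have hle : minPotential (c + Pi.single p 1) ≤ minPotential c + 1 := by
    refine (minPotential_le _ p).trans ?_
    rw [potential_step, mem_minSites.1 hp]
    simp
  have hge : minPotential c ≤ minPotential (c + Pi.single p 1) := by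
    refine le_minPotential fun i => (minPotential_le c i).trans ?_
    rw [potential_step]
    omega
  rcases Nat.lt_or_ge (minPotential c) (minPotential (c + Pi.single p 1)) with hlt | hge'
  · rw [show minPotential (c + Pi.single p 1) = minPotential c + 1 by omega]
    exact h1.succ
  · rwa [show minPotential (c + Pi.single p 1) = minPotential c by omega]

theorem spreadAt_zero : SpreadAt (minPotential (0 : Config M)) (0 : Config M) := by
  have h : ∀ i, potential (0 : Config M) i = 0 := fun i => by simp [potential]
  have hm : minPotential (0 : Config M) = 0 := by
    obtain ⟨q, hq⟩ := minSites_nonempty (0 : Config M)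
    rw [← mem_minSites.1 hq, h]
  rw [hm]
  constructor <;> simp [h]

/-- Two adjacent sites outside `P` would be guarded by isolated sites on their outer sides, at
levels n or n + 1 and strictly below them. Every such choice of four potentials contains a pattern
that `SpreadAt` forbids. -/
theorem Tame.mem_nbhd_of_spreadAt {P : Finset (ZMod M)} {c : Config M} (hP : Guarded P)
    (hc : Tame P c) (h : SpreadAt (minPotential c) c) {j : ZMod M} (hj : j ∉ P) :
    j - 1 ∈ P ∧ j + 1 ∈ P := by
  have key : ∀ j, j ∉ P → j + 1 ∈ P := by
    intro j hj
    by_contra hj1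
    have f1 : j + 1 - 1 = j := by ring
    have f2 : j + 1 + 1 = j + 2 := by ring
    have f3 : j - 1 + 1 = j := by ring
    have f4 : j - 1 + 2 = j + 1 := by ring
    have f5 : j - 1 + 3 = j + 2 := by ring
    have f6 : j + 2 - 1 = j + 1 := by ring
    have hl : Iso P (j - 1) := (hP j hj).resolve_right fun h => hj1 h.1
    have hr : Iso P (j + 2) := by
      have := (hP (j + 1) hj1).resolve_left fun h => hj (by rw [f1] at h; exact h.1)
      rwa [f2] at this
    have a1 := (hc.iso _ hl).2
    have a2 := (hc.iso _ hr).1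
    have a3 := hc.le _ hl.1
    have a4 := hc.le _ hr.1
    have a5 := minPotential_le c (j - 1)
    have a6 := minPotential_le c (j + 2)
    have b1 := h.pair j
    have b2 := h.left (j - 1)
    have b3 := h.right j
    have b4 := h.gap (j - 1)
    rw [f3] at a1
    rw [f6] at a2
    rw [f3, f4] at b2
    rw [f3, f4, f5] at b4
    omega
  refine ⟨?_, key j hj⟩
  by_contra h'
  have := key _ h'
  rw [sub_add_cancel] at this
  exact hj this

/-! ### Almost sure convergence -/

/-- A shift-invariant event that is almost impossible from the absorbing configurations with the
property `Q` is almost impossible from every configuration with the property `Q`. -/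
theorem law_eq_zero_of_absorbing (hM : 4 ≤ M) {Q : Config M → Prop}
    (hQ : ∀ c, Q c → ∀ i ∈ minSites c, Q (c + Pi.single i 1))
    {E : Set (ℕ → Config M)} (hE : MeasurableSet E) (hs : ∀ ξ, shift ξ ∈ E ↔ ξ ∈ E)
    (h : ∀ P c, Guarded P → Tame P c → Q c → law c E = 0) {c : Config M} (hc : Q c) :
    law c E = 0 := by
  classical
  -- Cutting the harmonic function off where `Q` fails keeps it subharmonic, because steps never
  -- leave `Q`.
  have key := eq_zero_of_subharmonic hM (h := fun c => if Q c then (law c).real E else 0)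
    (fun c => by split_ifs; exacts [measureReal_nonneg, le_rfl])
    (fun c => by split_ifs; exacts [measureReal_le_one, zero_le_one])
    (fun c => ?_) (fun P c hP hT => ?_) c
  · rw [if_pos hc, measureReal_eq_zero_iff] at key
    exact key
  · by_cases hq : Q c
    · rw [if_pos hq, law_real_eq_average c hE hs]
      refine Finset.sum_le_sum fun i hi => ?_
      rw [if_pos (hQ c hq i hi)]
    · rw [if_neg hq, mul_zero]
      refine Finset.sum_nonneg fun i _ => ?_
      split_ifs
      exacts [measureReal_nonneg, le_rfl]
  · split_ifs with hq
    · rw [measureReal_eq_zero_iff]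
      exact h P c hP hT hq
    · rfl

/-! ### Finiteness of the set of limits, and settling as a measurable shift-invariant event. -/

/-- The coordinates in units of α/2 are digits 0, 1, 2, and normalisation to sum 1 determines α from
these digits. -/
theorem ruleSet_finite : (ruleSet M).Finite := by
  have h : ruleSet M ⊆ Set.range fun (p : ZMod M → Fin 3) (i : ZMod M) =>
      (p i : ℝ) / ∑ j, (p j : ℝ) := by
    rintro x ⟨α, hx⟩
    have hα := hx.pos
    choose p hp using fun i => (show ∃ k : Fin 3, x i = (k : ℝ) * (α / 2) by
      rcases hx.mem i with e | e | e
      · exact ⟨0, by rw [e]; simp⟩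
      · exact ⟨1, by rw [e]; simp⟩
      · exact ⟨2, by rw [e]; norm_num; ring⟩)
    refine ⟨p, ?_⟩
    have hs : (∑ j, (p j : ℝ)) * (α / 2) = 1 := by
      rw [← hx.sum_eq, Finset.sum_mul]
      exact Finset.sum_congr rfl fun i _ => (hp i).symm
    have hs0 : (∑ j, (p j : ℝ)) ≠ 0 := fun h0 => by rw [h0, zero_mul] at hs; exact zero_ne_one hs
    funext i
    rw [hp i, div_eq_iff hs0, mul_assoc, mul_comm (α / 2), hs, mul_one]
  exact (Set.finite_range _).subset h

/-- The trajectory converges to `x`, and adsorption stops exactly where `x` vanishes. -/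
structure Settles (ξ : ℕ → Config M) (x : ZMod M → ℝ) : Prop where
  hasLimit : HasLimit ξ x
  const_iff : ∀ i, (∃ T : ℕ, ∀ t, T ≤ t → ξ t i = ξ T i) ↔ x i = 0
  unbounded_iff : ∀ i, (⨆ t : ℕ, (ξ t i : ℕ∞)) = ⊤ ↔ 0 < x i

theorem HasLimit.unique {ξ : ℕ → Config M} {x y : ZMod M → ℝ} (hx : HasLimit ξ x)
    (hy : HasLimit ξ y) : x = y :=
  tendsto_nhds_unique hx hy

theorem iSup_eq_top_of_hasLimit {ξ : ℕ → Config M} {x : ZMod M → ℝ} (h : HasLimit ξ x)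
    {i : ZMod M} (hi : 0 < x i) : (⨆ t : ℕ, (ξ t i : ℕ∞)) = ⊤ := by
  have h1 : Tendsto (fun t : ℕ => (ξ t i : ℝ) / t * t) atTop atTop :=
    Tendsto.pos_mul_atTop hi (tendsto_pi_nhds.1 h i) tendsto_natCast_atTop_atTop
  have h2 : Tendsto (fun t : ℕ => (ξ t i : ℝ)) atTop atTop := by
    refine h1.congr' ?_
    filter_upwards [eventually_gt_atTop 0] with t ht
    have : (t : ℝ) ≠ 0 := by exact_mod_cast ht.ne'
    field_simp
  rw [ENat.iSup_natCast_eq_top]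
  rintro ⟨b, hb⟩
  obtain ⟨t, ht⟩ := (h2.eventually_gt_atTop (b : ℝ)).exists
  have : ξ t i ≤ b := hb ⟨t, rfl⟩
  exact absurd (by exact_mod_cast ht) (not_lt.2 this)

theorem eq_zero_of_hasLimit {ξ : ℕ → Config M} {x : ZMod M → ℝ} (h : HasLimit ξ x)
    {i : ZMod M} {T : ℕ} (hT : ∀ t, T ≤ t → ξ t i = ξ T i) : x i = 0 := by
  refine tendsto_nhds_unique (tendsto_pi_nhds.1 h i)
    ((tendsto_const_div_nat (ξ T i : ℝ)).congr' ?_)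
  filter_upwards [eventually_ge_atTop T] with t ht
  rw [hT t ht]

theorem Absorbed.settles {P : Finset (ZMod M)} {ξ : ℕ → Config M} (hM : 4 ≤ M)
    (h : Absorbed P ξ) : Settles ξ fun i => weight P i / blocks P := by
  have hlim := h.hasLimit hM
  obtain ⟨q, hq⟩ := minSites_nonempty (ξ 0)
  have hn : 0 < blocks P := blocks_pos ((h.tame 0).mem hq)
  have hpos : ∀ i, 0 < weight P i / blocks P ↔ i ∈ P := fun i => by
    rw [div_pos_iff_of_pos_right hn, weight_pos_iff]
  refine ⟨hlim, fun i => ⟨fun ⟨T, hT⟩ => eq_zero_of_hasLimit hlim hT, fun h0 => ?_⟩,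
    fun i => ⟨fun htop => ?_, fun hi => iSup_eq_top_of_hasLimit hlim hi⟩⟩
  · have hi : i ∉ P := fun hi => ((hpos i).2 hi).ne' h0
    exact ⟨0, fun t _ => h.const hi t⟩
  · rw [hpos]
    by_contra hi
    simp only [h.const hi, ciSup_const] at htop
    exact ENat.natCast_ne_top _ htop

theorem hasLimit_shift {ξ : ℕ → Config M} {x : ZMod M → ℝ} :
    HasLimit (shift ξ) x ↔ HasLimit ξ x := by
  have hratio : Tendsto (fun t : ℕ => ((t : ℝ) + 1) / t) atTop (𝓝 1) := by
    have h := (tendsto_const_div_nat 1).const_add 1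
    rw [add_zero] at h
    refine h.congr' ?_
    filter_upwards [eventually_gt_atTop 0] with t ht
    have : (t : ℝ) ≠ 0 := by exact_mod_cast ht.ne'
    field_simp
  unfold HasLimit
  rw [tendsto_pi_nhds, tendsto_pi_nhds]
  refine forall_congr' fun i => ?_
  rw [← tendsto_add_atTop_iff_nat (f := fun t : ℕ => (ξ t i : ℝ) / t) 1]
  constructor
  · intro h
    have h1 := h.div hratio one_ne_zero
    rw [div_one] at h1
    refine h1.congr' ?_
    filter_upwards [eventually_gt_atTop 0] with t ht
    have h2 : (t : ℝ) ≠ 0 := by exact_mod_cast ht.ne'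
    have h3 : (t : ℝ) + 1 ≠ 0 := by positivity
    simp only [shift]
    push_cast
    simp only [Pi.div_apply]
    field_simp
  · intro h
    have h1 := h.mul hratio
    rw [mul_one] at h1
    refine h1.congr' ?_
    filter_upwards [eventually_gt_atTop 0] with t ht
    have h2 : (t : ℝ) ≠ 0 := by exact_mod_cast ht.ne'
    have h3 : (t : ℝ) + 1 ≠ 0 := by positivity
    simp only [shift]
    push_cast
    field_simp

/-- Settling depends only on the tail of the trajectory; this invariance makes its probability
harmonic in the starting point. -/
theorem settles_shift {ξ : ℕ → Config M} {x : ZMod M → ℝ} :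
    Settles (shift ξ) x ↔ Settles ξ x := by
  have h1 : ∀ i, (∃ T : ℕ, ∀ t, T ≤ t → shift ξ t i = shift ξ T i) ↔
      ∃ T : ℕ, ∀ t, T ≤ t → ξ t i = ξ T i := by
    intro i
    constructor
    · rintro ⟨T, hT⟩
      refine ⟨T + 1, fun t ht => ?_⟩
      obtain ⟨s, rfl⟩ := Nat.exists_eq_add_of_le' (show 1 ≤ t by omega)
      exact hT s (by omega)
    · rintro ⟨T, hT⟩
      refine ⟨T, fun t ht => ?_⟩
      simp only [shift]
      rw [hT (t + 1) (by omega), hT (T + 1) (by omega)]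
  have h2 : ∀ i, (⨆ t : ℕ, (shift ξ t i : ℕ∞)) = ⊤ ↔ (⨆ t : ℕ, (ξ t i : ℕ∞)) = ⊤ := by
    intro i
    rw [← sup_iSup_nat_succ fun t => (ξ t i : ℕ∞), max_eq_top]
    simp [shift]
  constructor
  · exact fun h => ⟨hasLimit_shift.1 h.1, fun i => (h1 i).symm.trans (h.2 i),
      fun i => (h2 i).symm.trans (h.3 i)⟩
  · exact fun h => ⟨hasLimit_shift.2 h.1, fun i => (h1 i).trans (h.2 i),
      fun i => (h2 i).trans (h.3 i)⟩

theorem measurableSet_hasLimit (x : ZMod M → ℝ) : MeasurableSet {ξ | HasLimit ξ x} := by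
  refine measurableSet_tendsto _ fun t => ?_
  exact (Measurable.of_discrete (f := fun (c : Config M) (i : ZMod M) =>
    (c i : ℝ) / (t : ℝ))).comp (measurable_pi_apply t)

theorem measurableSet_settles (x : ZMod M → ℝ) : MeasurableSet {ξ | Settles ξ x} := by
  have hev : ∀ (t : ℕ) (i : ZMod M), Measurable fun ξ : ℕ → Config M => ξ t i :=
    fun t i => (measurable_pi_apply i).comp (measurable_pi_apply t)
  have h1 : ∀ i, MeasurableSet {ξ : ℕ → Config M | ∃ T : ℕ, ∀ t, T ≤ t → ξ t i = ξ T i} := by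
    intro i
    have : {ξ : ℕ → Config M | ∃ T : ℕ, ∀ t, T ≤ t → ξ t i = ξ T i} =
        ⋃ T : ℕ, ⋂ t : ℕ, ⋂ _ : T ≤ t, {ξ | ξ t i = ξ T i} := by
      ext ξ; simp
    rw [this]
    exact .iUnion fun T => .iInter fun t => .iInter fun _ => measurableSet_eq_fun (hev t i) (hev T i)
  have h2 : ∀ i, MeasurableSet {ξ : ℕ → Config M | (⨆ t : ℕ, (ξ t i : ℕ∞)) = ⊤} := by
    intro i
    have : {ξ : ℕ → Config M | (⨆ t : ℕ, (ξ t i : ℕ∞)) = ⊤} =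
        ⋂ b : ℕ, ⋃ t : ℕ, (fun ξ => ξ t i) ⁻¹' Set.Ioi b := by
      ext ξ
      rw [Set.mem_ofPred_eq, ENat.iSup_natCast_eq_top, not_bddAbove_iff]
      simp
    rw [this]
    exact .iInter fun b => .iUnion fun t => hev t i measurableSet_Ioi
  have : {ξ | Settles ξ x} = {ξ | HasLimit ξ x} ∩
      ((⋂ i, {ξ | (∃ T : ℕ, ∀ t, T ≤ t → ξ t i = ξ T i) ↔ x i = 0}) ∩
      ⋂ i, {ξ | (⨆ t : ℕ, (ξ t i : ℕ∞)) = ⊤ ↔ 0 < x i}) := by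
    ext ξ
    simp only [Set.mem_inter_iff, Set.mem_iInter, Set.mem_ofPred_eq]
    exact ⟨fun h => ⟨h.1, h.2, h.3⟩, fun h => ⟨h.1, h.2.1, h.2.2⟩⟩
  rw [this]
  refine (measurableSet_hasLimit x).inter (.inter (.iInter fun i => ?_) (.iInter fun i => ?_))
  · by_cases hx : x i = 0
    · simpa [hx] using h1 i
    · simp only [hx, iff_false]
      exact (h1 i).compl
  · by_cases hx : 0 < x i
    · simpa only [hx, iff_true] using h2 i
    · simp only [hx, iff_false]
      exact (h2 i).compl

theorem ae_exists_settles (hM : 4 ≤ M) {Q : Config M → Prop}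
    (hQ : ∀ c, Q c → ∀ i ∈ minSites c, Q (c + Pi.single i 1)) {R : (ZMod M → ℝ) → Prop}
    (hR : ∀ P c, Guarded P → Tame P c → Q c → R fun i => weight P i / blocks P)
    {η : Config M} (hη : Q η) :
    ∀ᵐ ξ ∂(law η), ∃ x ∈ ruleSet M, R x ∧ Settles ξ x := by
  have hmeas : MeasurableSet {ξ | ∃ x ∈ ruleSet M, R x ∧ Settles ξ x} := by
    have : {ξ | ∃ x ∈ ruleSet M, R x ∧ Settles ξ x} =
        ⋃ x ∈ {x ∈ ruleSet M | R x}, {ξ | Settles ξ x} := by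
      ext ξ
      simp only [Set.mem_iUnion, Set.mem_ofPred_eq, exists_prop, and_assoc]
    rw [this]
    exact (ruleSet_finite.subset (Set.sep_subset _ _)).measurableSet_biUnion
      fun x _ => measurableSet_settles x
  refine law_eq_zero_of_absorbing hM hQ (E := {ξ | ∃ x ∈ ruleSet M, R x ∧ Settles ξ x}ᶜ)
    hmeas.compl (fun ξ => ?_) (fun P c hP hc hq => ?_) hη
  · simp only [Set.mem_compl_iff, Set.mem_ofPred_eq, settles_shift]
  · have : ∀ᵐ ξ ∂(law c), ∃ x ∈ ruleSet M, R x ∧ Settles ξ x := by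
      filter_upwards [ae_absorbed hM hP hc] with ξ hξ
      exact ⟨_, ⟨_, hc.rules hM hP⟩, hR P c hP hc hq, hξ.settles hM⟩
    exact this

open Classical in
/-- The limit of a trajectory, if it satisfies the rules, and zero otherwise. -/
def limitConfig (ξ : ℕ → Config M) : ZMod M → ℝ :=
  ∑ x ∈ (ruleSet_finite (M := M)).toFinset, if HasLimit ξ x then x else 0

theorem limitConfig_eq {ξ : ℕ → Config M} {x : ZMod M → ℝ} (hx : x ∈ ruleSet M)
    (h : HasLimit ξ x) : limitConfig ξ = x := by
  unfold limitConfig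
  rw [Finset.sum_eq_single x, if_pos h]
  · intro y _ hy
    exact if_neg fun h' => hy (h'.unique h)
  · intro hx'
    simp [hx] at hx'

theorem measurable_limitConfig : Measurable (limitConfig (M := M)) :=
  Finset.measurable_sum _ fun x _ =>
    Measurable.ite (measurableSet_hasLimit x) measurable_const measurable_const

end Growth

end

/-! ### The main theorem. -/

theorem theorem2p2 (M : ℕ) [NeZero M] (hM : 4 ≤ M) :
    -- for every initial configuration, almost surely the limit exists; it is a random variable
    -- with finitely many values, each of positive probability
    (∀ η : Growth.Config M, ∃ X : (ℕ → Growth.Config M) → (ZMod M → ℝ), Measurable X ∧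
      (∀ᵐ ξ ∂(Growth.law η), Growth.HasLimit ξ (X ξ)) ∧
      (∃ S : Finset (ZMod M → ℝ), (S : Set (ZMod M → ℝ)) ⊆ Growth.ruleSet M ∧
        (∀ᵐ ξ ∂(Growth.law η), X ξ ∈ S) ∧
        ∀ x ∈ S, 0 < Growth.law η {ξ | X ξ = x}) ∧
      -- adsorption stops exactly where the limit vanishes
      (∀ᵐ ξ ∂(Growth.law η), ∀ i : ZMod M,
        ((∃ T : ℕ, ∀ t, T ≤ t → ξ t i = ξ T i) ↔ X ξ i = 0) ∧
        ((⨆ t : ℕ, (ξ t i : ℕ∞)) = ⊤ ↔ 0 < X ξ i)) ∧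
      -- the empty initial configuration
      (η = 0 → ∀ᵐ ξ ∂(Growth.law η), ∀ i : ZMod M,
        X ξ i = 0 → 0 < X ξ (i - 1) ∧ 0 < X ξ (i + 1))) ∧
    -- the set of limiting configurations is finite and is described by the rules
    (Growth.ruleSet M).Finite ∧
    {x : ZMod M → ℝ | ∃ η : Growth.Config M, 0 < Growth.law η {ξ | Growth.HasLimit ξ x}} =
      Growth.ruleSet M := by
  classical
  have hae : ∀ η : Growth.Config M, ∀ᵐ ξ ∂(Growth.law η),
      Growth.limitConfig ξ ∈ Growth.ruleSet M ∧ Growth.Settles ξ (Growth.limitConfig ξ) := by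
    intro η
    filter_upwards [Growth.ae_exists_settles hM (Q := fun _ => True) (fun _ _ _ _ => trivial)
      (R := fun _ => True) (fun _ _ _ _ _ => trivial) (η := η) trivial] with ξ ⟨x, hx, _, hξ⟩
    rw [Growth.limitConfig_eq hx hξ.hasLimit]
    exact ⟨hx, hξ⟩
  refine ⟨fun η => ⟨Growth.limitConfig, Growth.measurable_limitConfig, ?_, ?_, ?_, ?_⟩,
    Growth.ruleSet_finite, ?_⟩
  · filter_upwards [hae η] with ξ hξ
    exact hξ.2.hasLimit
  -- `S` collects the atoms of the law of the limit; the remaining rule configurations are finitely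
  -- many null values.
  · refine ⟨(Growth.ruleSet_finite (M := M)).toFinset.filter fun x =>
      0 < Growth.law η {ξ | Growth.limitConfig ξ = x}, fun x hx => ?_, ?_, fun x hx => ?_⟩
    · simp only [Finset.coe_filter, Set.Finite.mem_toFinset] at hx
      exact hx.1
    · have hnull : ∀ᵐ ξ ∂(Growth.law η), ∀ x ∈ Growth.ruleSet M,
          Growth.law η {ξ | Growth.limitConfig ξ = x} = 0 → Growth.limitConfig ξ ≠ x := by
        refine (ae_ball_iff Growth.ruleSet_finite.countable).2 fun x _ => ?_
        by_cases h0 : Growth.law η {ξ | Growth.limitConfig ξ = x} = 0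
        · filter_upwards [measure_eq_zero_iff_ae_notMem.1 h0] with ξ hξ _
          exact hξ
        · exact Eventually.of_forall fun ξ h => absurd h h0
      filter_upwards [hae η, hnull] with ξ h1 h2
      refine Finset.mem_filter.2 ⟨(Set.Finite.mem_toFinset _).2 h1.1, pos_iff_ne_zero.2 fun h0 => ?_⟩
      exact h2 _ h1.1 h0 rfl
    · exact (Finset.mem_filter.1 hx).2
  · filter_upwards [hae η] with ξ hξ i
    exact ⟨hξ.2.const_iff i, hξ.2.unbounded_iff i⟩
  -- Here absorption is applied within the class of configurations satisfying the spread invariant,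
  -- which contains the empty one and is closed under steps.
  · rintro rfl
    filter_upwards [Growth.ae_exists_settles hM
      (Q := fun c => Growth.SpreadAt (Growth.minPotential c) c)
      (fun c hc i hi => hc.step hM hi)
      (R := fun x => ∀ i, x i = 0 → 0 < x (i - 1) ∧ 0 < x (i + 1))
      (fun P c hP hc hq i hi => by
        obtain ⟨q, hqm⟩ := Growth.minSites_nonempty c
        have hn := Growth.blocks_pos (hc.mem hqm)
        have hiP : i ∉ P := fun h =>
          (div_pos (Growth.weight_pos_iff.2 h) hn).ne' hi
        obtain ⟨h1, h2⟩ := hc.mem_nbhd_of_spreadAt hP hq hiP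
        exact ⟨div_pos (Growth.weight_pos_iff.2 h1) hn, div_pos (Growth.weight_pos_iff.2 h2) hn⟩)
      Growth.spreadAt_zero] with ξ ⟨x, hx, hR, hξ⟩
    rw [Growth.limitConfig_eq hx hξ.hasLimit]
    exact hR
  · ext x
    constructor
    · rintro ⟨η, hη⟩
      by_contra hx
      refine hη.ne' (measure_eq_zero_iff_ae_notMem.2 ?_)
      filter_upwards [hae η] with ξ hξ h
      exact hx (Growth.HasLimit.unique h hξ.2.hasLimit ▸ hξ.1)
    · rintro ⟨α, hx⟩
      -- Started inside an absorbing configuration for its own support, the process converges to `x`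
      -- with probability 1.
      obtain ⟨P, η, hP, hη, rfl⟩ := Growth.exists_tame_of_rules hM hx
      refine ⟨η, ?_⟩
      have h1 : ∀ᵐ ξ ∂(Growth.law η),
          Growth.HasLimit ξ fun i => Growth.weight P i / Growth.blocks P := by
        filter_upwards [Growth.ae_absorbed hM hP hη] with ξ hξ
        exact hξ.hasLimit hM
      rw [(mem_ae_iff_prob_eq_one (Growth.measurableSet_hasLimit _)).1 h1]
      exact one_pos
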